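/- Let $\mathbb D=\{z\in\mathbb C:|z|<1\}$ and let $\mathcal A$ be the class of functions $f$ analytic in $\mathbb D$ with $f(0)=0$, $f'(0)=1$. For real $\alpha,\gamma,\beta$ with $\beta<1$, let $W_\beta(\alpha,\gamma)$ be the class of $f\in\mathcal A$ for which there is a $\theta\in\mathbb R$ with $$\operatorname{Re}\Big(e^{i\theta}\Big((1-\alpha+2\gamma)\frac{f(z)}{z}+(\alpha-2\gamma)f'(z)+\gamma zf''(z)-\beta\Big)\Big)>0\qquad(z\in\mathbb D),$$ where $f(z)/z$ is given the value $1$ at $z=0$. For $0\le\xi\le1$, let $M(\xi)$ be the class of $F\in\mathcal A$ with $$\operatorname{Re}\frac{\xi z(zF'(z))'+(1-\xi)zF'(z)}{\xi zF'(z)+(1-\xi)F(z)}>0\qquad(z\in\mathbb D)$$ (the quotient has the value $1$ at $z=0$, and its denominator does not vanish for $0<|z|<1$). Let $0\le\xi\le 1$, $\gamma>0$, and let $\mu\ge1$, $\nu\ge0$ satisfy $\mu+\nu=\alpha-\gamma$ and $\mu\nu=\gamma$. Let $A,B,C$ be real with $B<1$ and $$B<\min\Big(2+\frac1\mu,\;C-A-1\Big).$$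 Let $\varphi$ be twice continuously differentiable on $(0,1)$ with $\varphi>0$, $\varphi'\ge0$ and $\varphi''\ge0$ there (for example $\varphi(x)=1+\sum_{n\ge1}b_nx^n$ with $b_n\ge0$, convergent on $(0,1)$), and let $$\lambda(t)=k\,t^{B-1}(1-t)^{C-A-B}\varphi(1-t),\qquad 0<t<1,$$ be integrable, with the constant $k$ such that $\int_0^1\lambda(t)\,dt=1$. Let $q$ be the solution of $$\frac{d}{dt}\big(t^{1/\nu}q(t)\big)=\frac1{\mu\nu}\,t^{1/\nu-1}\int_0^1 s^{1/\mu-1}\frac{1-st}{(1+st)^3}\,ds\qquad(0<t<1)$$ that is continuous at $0$ from the right with $q(0)=1$, and let $\beta<1$ satisfy $$\frac{\beta-\frac12}{1-\beta}=-\int_0^1\lambda(t)q(t)\,dt.$$ If $f\in W_\beta(\alpha,\gamma)$, then the function $$V_\lambda(f)(z)=\int_0^1\lambda(t)\,\frac{f(tz)}{t}\,dt=k\int_0^1t^{B-1}(1-t)^{C-A-B}\varphi(1-t)\,\frac{f(tz)}{t}\,dt$$ belongs to $M(\xi)$. -/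

import Mathlib

namespace PascuTransform

/-- The class `A`: functions analytic in the open unit disc with `f 0 = 0` and `f' 0 = 1`. -/
def ClassA (f : ℂ → ℂ) : Prop :=
  DifferentiableOn ℂ f (Metric.ball 0 1) ∧ f 0 = 0 ∧ deriv f 0 = 1

/-- The class `W_β(α, γ)`. The quotient `f(z)/z` is written `dslope f 0 z`, which is `f z / z`
for `z ≠ 0` (as `f 0 = 0`) and takes the limit value `f' 0 = 1` at `z = 0`. -/
def ClassW (β α γ : ℝ) (f : ℂ → ℂ) : Prop :=
  ClassA f ∧ ∃ θ : ℝ, ∀ z ∈ Metric.ball (0 : ℂ) 1,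
    0 < (Complex.exp (θ * Complex.I) *
      ((1 - α + 2 * γ) * dslope f 0 z + (α - 2 * γ) * deriv f z
        + γ * z * deriv (deriv f) z - β)).re

/-- The Pascu class `M(ξ)`. At `z = 0` the quotient has the removable value `1`, so that point
carries no condition; where the denominator vanished the Lean quotient would be `0`, so the
strict inequality forces the denominator to be nonzero for `0 < |z| < 1`. -/
def ClassM (ξ : ℝ) (F : ℂ → ℂ) : Prop :=
  ClassA F ∧ ∀ z ∈ Metric.ball (0 : ℂ) 1, z ≠ 0 →
    0 < ((ξ * z * deriv (fun w => w * deriv F w) z + (1 - ξ) * (z * deriv F z)) /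
      (ξ * (z * deriv F z) + (1 - ξ) * F z)).re

/-- The integral transform `V_λ(f)(z) = ∫₀¹ λ(t) f(tz)/t dt`. -/
noncomputable def transform (lam : ℝ → ℝ) (f : ℂ → ℂ) (z : ℂ) : ℂ :=
  ∫ t in (0 : ℝ)..1, (lam t : ℂ) * (f (t * z) / t)

/-- `q` solves, on `(0,1)`, the equation
`d/dt (t^(1/ν) q(t)) = (1/(μν)) t^(1/ν-1) ∫₀¹ s^(1/μ-1) (1-st)/(1+st)³ ds`
and is continuous at `0` from the right with `q 0 = 1`. -/
structure IsConvexKernel (μ ν : ℝ) (q : ℝ → ℝ) : Prop where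
  init : q 0 = 1
  cont : ContinuousWithinAt q (Set.Ici 0) 0
  ode : ∀ t ∈ Set.Ioo (0 : ℝ) 1,
    HasDerivAt (fun x : ℝ => x ^ (1 / ν) * q x)
      (1 / (μ * ν) * t ^ (1 / ν - 1) *
        ∫ s in (0 : ℝ)..1, s ^ (1 / μ - 1) * ((1 - s * t) / (1 + s * t) ^ 3)) t

/-- The factor `φ`: twice continuously differentiable and positive on `(0,1)`, with nonnegative
first and second derivatives there. Every power series `1 + ∑ bₙ xⁿ` with `bₙ ≥ 0` that converges
on `(0,1)` is of this kind. -/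
structure IsHypergeometricFactor (φ : ℝ → ℝ) : Prop where
  contDiff : ContDiffOn ℝ 2 φ (Set.Ioo 0 1)
  pos : ∀ x ∈ Set.Ioo (0 : ℝ) 1, 0 < φ x
  deriv_nonneg : ∀ x ∈ Set.Ioo (0 : ℝ) 1, 0 ≤ deriv φ x
  deriv_deriv_nonneg : ∀ x ∈ Set.Ioo (0 : ℝ) 1, 0 ≤ deriv (deriv φ) x

/-- The weight `λ(t) = k t^(B-1) (1-t)^(C-A-B) φ(1-t)`. -/
noncomputable def weight (k A B C : ℝ) (φ : ℝ → ℝ) (t : ℝ) : ℝ :=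
  k * t ^ (B - 1) * (1 - t) ^ (C - A - B) * φ (1 - t)

end PascuTransform

namespace PascuTransform

open MeasureTheory Set Filter Topology

/-! Expand everything in power series on the disc. If f = Σ aₙzⁿ, the expression H that defines
W_β(α,γ) has coefficients (1+μn)(1+νn)aₙ₊₁, and the transform multiplies aₙ₊₁ by the moment Λₙ =
∫λ(t)tⁿdt. By `re_div_pos_of_forall`, Re(X/Y) > 0 once Re e^{iθ}((1-w)Y + wX) > 0 for every w in the
closed disc |w - 1/2| ≤ 1/2. For the numerator X and denominator Y of the Pascu quotient, both
divided by z, this combination has coefficients (1+nw)(1+ξn)Λₙaₙ₊₁. It is therefore the Hadamard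
product of (H-β)/(1-β) with K = β + (1-β) Σ (1+nw)(1+ξn)/((1+μn)(1+νn)) Λₙzⁿ. Such a product stays
in the half-plane when Re K ≥ 1/2 (`HasDiscSeries.convolution_re_pos`), and the equation for β turns
Re K ≥ 1/2 into the lower bound ∫λq for the real part of the series.

That bound comes from a one-parameter inequality of Fournier–Ruscheweyh type: with h_w(u) =
Σ(1+nw)uⁿ, the integral of λ(t)(Re h_w(tu) - (1+t|u|)⁻²) is nonnegative. The weight λ is
nonnegative, decreasing, convex and tends to 0 at 1, so it behaves like a mixture of the weights
(c-t)₊. For these the inequality is proved with an explicit comparison function along each ray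
(`integral_rayKernel_nonneg`).

Finally q is an iterated multiplicative average of (1+x)⁻², with power densities whose moments are
1/(1+μn) and 1/(1+νn). Averaging the one-parameter inequality in the same way produces the
two-parameter one. The passage from 1 to ξ costs nothing because x ↦ ∫λ(t)(1+tx)⁻²dt decreases
(`integral_mul_convexKernel_le`). -/

/-! ### The extremal inequality along a ray, for the weights (R - T)₊. -/

/-- `|1 - T ε|²` for a unit complex number `ε` with real part `c`. -/
noncomputable def rayDist (c T : ℝ) : ℝ := 1 - 2 * c * T + T ^ 2

/-- The real part of `u / (1 - u)` minus its value at `-T`, where `u = T ε`, scaled by `T`. -/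
noncomputable def rayGap (c T : ℝ) : ℝ := T ^ 2 * (1 - T) * (1 + c) / ((1 + T) * rayDist c T)

/-- A primitive of the discriminant weight `(1 - T) (1 + T)³ (1 - c) / (4 D³)`. -/
noncomputable def rayPrim (c T : ℝ) : ℝ :=
  (1 - c) * (T / rayDist c T + (1 + c) * (T / rayDist c T) ^ 2) / 4

lemma rayDist_pos {c T : ℝ} (hc : c ^ 2 ≤ 1) (hT0 : 0 ≤ T) (hT1 : T < 1) : 0 < rayDist c T := by
  unfold rayDist
  have h1 : c ≤ 1 := by nlinarith
  nlinarith [mul_nonneg hT0 (sub_nonneg.2 h1), sq_pos_of_pos (sub_pos.2 hT1)]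

lemma hasDerivAt_rayDist (c T : ℝ) : HasDerivAt (rayDist c) (2 * T - 2 * c) T := by
  unfold rayDist
  have := (((hasDerivAt_id T).const_mul (2 * c)).const_sub 1).add ((hasDerivAt_id T).pow 2)
  refine (this.congr_deriv ?_)
  simp; ring

/-- For u = Tε, the function T/(1-u) has derivative 1/(1-u)². The gap is the real part of T/(1-u)
minus the same function at ε = -1, so it is a primitive of the part of `rayKernel` that multiplies
p. -/
lemma hasDerivAt_rayGap {c T : ℝ} (hc : c ^ 2 ≤ 1) (hT0 : 0 ≤ T) (hT1 : T < 1) :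
    HasDerivAt (rayGap c)
      (((1 - c * T) ^ 2 - (1 - c ^ 2) * T ^ 2) / rayDist c T ^ 2 - 1 / (1 + T) ^ 2) T := by
  have hD := rayDist_pos hc hT0 hT1
  have h1 : (0 : ℝ) < 1 + T := by linarith
  have hn : HasDerivAt (fun T : ℝ => T ^ 2 * (1 - T) * (1 + c))
      ((2 * T * (1 - T) - T ^ 2) * (1 + c)) T := by
    have := (((hasDerivAt_id T).pow 2).mul ((hasDerivAt_id T).const_sub 1)).mul_const (1 + c)
    refine this.congr_deriv ?_
    norm_num [-mul_eq_mul_right_iff]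
    ring
  have hd : HasDerivAt (fun T : ℝ => (1 + T) * rayDist c T)
      (rayDist c T + (1 + T) * (2 * T - 2 * c)) T := by
    have := ((hasDerivAt_id T).const_add 1).mul (hasDerivAt_rayDist c T)
    refine this.congr_deriv ?_
    simp
  have := hn.div hd (by positivity)
  refine this.congr_deriv ?_
  have hDe : rayDist c T = 1 - 2 * c * T + T ^ 2 := rfl
  field_simp
  rw [hDe]
  ring

lemma hasDerivAt_rayPrim {c T : ℝ} (hc : c ^ 2 ≤ 1) (hT0 : 0 ≤ T) (hT1 : T < 1) :
    HasDerivAt (rayPrim c)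
      ((1 - T) * (1 + T) ^ 3 * (1 - c) / (4 * rayDist c T ^ 3)) T := by
  have hD := rayDist_pos hc hT0 hT1
  have hv : HasDerivAt (fun T => T / rayDist c T)
      ((rayDist c T - T * (2 * T - 2 * c)) / rayDist c T ^ 2) T := by
    have := (hasDerivAt_id T).div (hasDerivAt_rayDist c T) hD.ne'
    refine this.congr_deriv ?_
    simp
  have := ((hv.add ((hv.pow 2).const_mul (1 + c))).const_mul (1 - c)).div_const 4
  refine this.congr_deriv ?_
  have hDe : rayDist c T = 1 - 2 * c * T + T ^ 2 := rfl
  norm_num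
  field_simp
  rw [hDe]
  ring

/-- The left side is the coefficient of 1-p that remains after the quadratic form is split off in
`integral_rayKernel_nonneg`. The factor 1+c reflects equality on the extremal ray ε = -1. -/
lemma ray_remainder_eq {c T R : ℝ} (hc : c ^ 2 ≤ 1) (hT0 : 0 ≤ T) (hT1 : T < 1) :
    (R - T) * ((1 - c * T) / rayDist c T - 1 / (1 + T) ^ 2 - 2 * rayPrim c T
      - (((1 - c * T) ^ 2 - (1 - c ^ 2) * T ^ 2) / rayDist c T ^ 2 - 1 / (1 + T) ^ 2) / 4)
      + rayGap c T / 4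
    = (1 + c) * T / (4 * (1 + T) ^ 2 * rayDist c T) *
      ((R - T) * (4 - 4 * T - 2 * T ^ 2) + T * (1 - T ^ 2)) := by
  have hD := rayDist_pos hc hT0 hT1
  have h1 : (0 : ℝ) < 1 + T := by linarith
  unfold rayPrim rayGap
  have hDe : rayDist c T = 1 - 2 * c * T + T ^ 2 := rfl
  field_simp
  rw [hDe]
  ring

lemma ray_remainder_nonneg {c T R : ℝ} (hc : c ^ 2 ≤ 1) (hT0 : 0 ≤ T) (hTR : T ≤ R) (hR : R < 1) :
    0 ≤ (R - T) * ((1 - c * T) / rayDist c T - 1 / (1 + T) ^ 2 - 2 * rayPrim c T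
      - (((1 - c * T) ^ 2 - (1 - c ^ 2) * T ^ 2) / rayDist c T ^ 2 - 1 / (1 + T) ^ 2) / 4)
      + rayGap c T / 4 := by
  have hT1 : T < 1 := hTR.trans_lt hR
  have hD := rayDist_pos hc hT0 hT1
  rw [ray_remainder_eq hc hT0 hT1]
  have hc1 : 0 ≤ 1 + c := by nlinarith
  refine mul_nonneg (by positivity) ?_
  have h2 : 0 ≤ T * (1 - T ^ 2) := mul_nonneg hT0 (by nlinarith)
  rcases le_total 0 (4 - 4 * T - 2 * T ^ 2) with h | h
  · exact add_nonneg (mul_nonneg (by linarith) h) h2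
  -- When the slope in R is nonpositive, the worst case is R = 1, where the bracket is a square
  -- times 4 + T.
  · have h3 : (1 - T) * (4 - 4 * T - 2 * T ^ 2) ≤ (R - T) * (4 - 4 * T - 2 * T ^ 2) :=
      mul_le_mul_of_nonpos_right (by linarith) h
    have h4 : (1 - T) * (4 - 4 * T - 2 * T ^ 2) + T * (1 - T ^ 2) = (1 - T) ^ 2 * (4 + T) := by ring
    have h5 : 0 ≤ (1 - T) ^ 2 * (4 + T) := by positivity
    linarith

/-- By the arithmetic-geometric mean inequality the two outer terms dominate twice the root of their
product, and q² ≤ p(1-p) with n² = 4ml bounds the middle term by exactly that. The condition on q is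
|w - 1/2| ≤ 1/2 for w = p + iq. -/
lemma quadratic_nonneg {p q m n l x : ℝ} (hp : 0 ≤ p) (hp1 : p ≤ 1) (hq : q ^ 2 ≤ p * (1 - p))
    (hm : 0 ≤ m) (hl : 0 ≤ l) (hn : n ^ 2 = 4 * m * l) :
    0 ≤ p * m - q * x * n + (1 - p) * x ^ 2 * l := by
  have h1 : (q * x * n) ^ 2 ≤ (p * m + (1 - p) * x ^ 2 * l) ^ 2 := by
    have h2 : (q * x * n) ^ 2 ≤ 4 * (p * m) * ((1 - p) * x ^ 2 * l) := by
      have : (q * x * n) ^ 2 = q ^ 2 * (x ^ 2 * (4 * m * l)) := by rw [← hn]; ring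
      rw [this]
      have h3 := mul_le_mul_of_nonneg_right hq (by positivity : 0 ≤ x ^ 2 * (4 * m * l))
      linarith
    nlinarith [sq_nonneg (p * m - (1 - p) * x ^ 2 * l)]
  have h0 : 0 ≤ p * m + (1 - p) * x ^ 2 * l :=
    add_nonneg (by positivity) (mul_nonneg (mul_nonneg (by linarith) (sq_nonneg _)) hl)
  linarith [(abs_le.1 (abs_le_of_sq_le_sq h1 h0)).2]

/-- The real part of `a + w (a² - a)` minus `1 / (1 + T)²` for `a = 1 / (1 - T ε)`,
`ε = c + i b` and `w = p + i q`. -/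
noncomputable def rayKernel (c b p q T : ℝ) : ℝ :=
  p * ((1 - c * T) ^ 2 - b ^ 2 * T ^ 2) / rayDist c T ^ 2 + (1 - p) * (1 - c * T) / rayDist c T
    - q * (b * T * (1 - T ^ 2) / rayDist c T ^ 2) - 1 / (1 + T) ^ 2

lemma continuousOn_rayKernel {c b p q : ℝ} (hc : c ^ 2 ≤ 1) :
    ContinuousOn (rayKernel c b p q) (Ico 0 1) := by
  intro T hT
  have hD := rayDist_pos hc hT.1 hT.2
  have hDc := (hasDerivAt_rayDist c T).continuousAt
  have h1 : (1 + T) ^ 2 ≠ 0 := by have := hT.1; positivity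
  have hD2 : rayDist c T ^ 2 ≠ 0 := by positivity
  refine ContinuousAt.continuousWithinAt ?_
  unfold rayKernel
  refine ContinuousAt.sub (ContinuousAt.sub (ContinuousAt.add ?_ ?_) ?_) ?_
  · exact ContinuousAt.div (by fun_prop) (hDc.pow 2) hD2
  · exact ContinuousAt.div (by fun_prop) hDc hD.ne'
  · exact ContinuousAt.mul (by fun_prop) (ContinuousAt.div (by fun_prop) (hDc.pow 2) hD2)
  · exact ContinuousAt.div (by fun_prop) (by fun_prop) h1

/-- The extremal inequality along a ray, for the weights `(R - T)₊`. -/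
theorem integral_rayKernel_nonneg {c b p q R : ℝ} (hcb : c ^ 2 + b ^ 2 = 1)
    (hpq : p ^ 2 + q ^ 2 ≤ p) (hR0 : 0 ≤ R) (hR1 : R < 1) :
    0 ≤ ∫ T in (0 : ℝ)..R, (R - T) * rayKernel c b p q T := by
  have hc : c ^ 2 ≤ 1 := by nlinarith [sq_nonneg b]
  have hb : b ^ 2 = 1 - c ^ 2 := by linarith
  have hp : 0 ≤ p := by nlinarith [sq_nonneg p, sq_nonneg q]
  have hp1 : p ≤ 1 := by nlinarith [sq_nonneg q]
  have hq : q ^ 2 ≤ p * (1 - p) := by nlinarith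
  have hc1 : c ≤ 1 := by nlinarith
  have hc2 : 0 ≤ 1 + c := by nlinarith
  -- X vanishes at both ends of [0,R] and X' lies below the integrand, so the integral is at least
  -- 0. In X, `rayGap` integrates the p-part; the quarter of it and the term with `rayPrim` create
  -- the quadratic form and a nonnegative remainder.
  set X : ℝ → ℝ := fun T => p * ((R - T) * rayGap c T)
    + (1 - p) * ((R - T) * rayGap c T / 4 - (R - T) ^ 2 * rayPrim c T) with hX
  set G' : ℝ → ℝ := fun T => ((1 - c * T) ^ 2 - (1 - c ^ 2) * T ^ 2) / rayDist c T ^ 2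
    - 1 / (1 + T) ^ 2 with hG'
  set l : ℝ → ℝ := fun T => (1 - T) * (1 + T) ^ 3 * (1 - c) / (4 * rayDist c T ^ 3) with hl
  have hder : ∀ T ∈ Icc (0 : ℝ) R, HasDerivAt X
      (p * (-rayGap c T + (R - T) * G' T) + (1 - p) * ((-rayGap c T + (R - T) * G' T) / 4
        - (-2 * (R - T) * rayPrim c T + (R - T) ^ 2 * l T))) T := by
    intro T hT
    have hT1 : T < 1 := hT.2.trans_lt hR1
    have h1 : HasDerivAt (fun T : ℝ => R - T) (-1) T := by
      simpa using (hasDerivAt_id T).const_sub R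
    have h2 := h1.mul (hasDerivAt_rayGap hc hT.1 hT1)
    have h3 := (h1.pow 2).mul (hasDerivAt_rayPrim hc hT.1 hT1)
    refine ((h2.const_mul p).add (((h2.div_const 4).sub h3).const_mul (1 - p))).congr_deriv ?_
    simp only [hG', hl]
    norm_num
  have hle : ∀ T ∈ Icc (0 : ℝ) R, (p * (-rayGap c T + (R - T) * G' T) + (1 - p) *
      ((-rayGap c T + (R - T) * G' T) / 4
        - (-2 * (R - T) * rayPrim c T + (R - T) ^ 2 * l T))) ≤ (R - T) * rayKernel c b p q T := by
    intro T hT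
    have hT1 : T < 1 := hT.2.trans_lt hR1
    have hT0 := hT.1
    have hD := rayDist_pos hc hT.1 hT1
    have h1T : 0 ≤ 1 - T := by linarith
    have h1c : 0 ≤ 1 - c := by linarith
    have hrem := ray_remainder_nonneg hc hT.1 hT.2 hR1
    have hm : 0 ≤ rayGap c T := by unfold rayGap; positivity
    have hl0 : 0 ≤ l T := by simp only [hl]; positivity
    -- The primitive `rayPrim` is designed for this identity: its derivative l makes the
    -- discriminant of the quadratic form degenerate.
    have hn : (b * T * (1 - T ^ 2) / rayDist c T ^ 2) ^ 2 = 4 * rayGap c T * l T := by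
      have : (b * T * (1 - T ^ 2) / rayDist c T ^ 2) ^ 2
          = (1 - c ^ 2) * T ^ 2 * (1 - T ^ 2) ^ 2 / rayDist c T ^ 4 := by
        rw [← hb]; field_simp
      rw [this]
      simp only [hl, rayGap]
      have h1 : (0 : ℝ) < 1 + T := by linarith
      field_simp
      ring
    have hquad := quadratic_nonneg (x := R - T) hp hp1 hq hm hl0 hn
    have hrem' := mul_nonneg (sub_nonneg.2 hp1) hrem
    have key : (R - T) * rayKernel c b p q T - (p * (-rayGap c T + (R - T) * G' T) + (1 - p) *
      ((-rayGap c T + (R - T) * G' T) / 4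
        - (-2 * (R - T) * rayPrim c T + (R - T) ^ 2 * l T))) =
      (p * rayGap c T - q * (R - T) * (b * T * (1 - T ^ 2) / rayDist c T ^ 2)
        + (1 - p) * (R - T) ^ 2 * l T) + (1 - p) *
        ((R - T) * ((1 - c * T) / rayDist c T - 1 / (1 + T) ^ 2 - 2 * rayPrim c T
      - (((1 - c * T) ^ 2 - (1 - c ^ 2) * T ^ 2) / rayDist c T ^ 2 - 1 / (1 + T) ^ 2) / 4)
      + rayGap c T / 4) := by
      simp only [rayKernel, hG', hb]
      ring
    linarith
  have hcont : ContinuousOn (fun T => (R - T) * rayKernel c b p q T) (Icc 0 R) :=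
    ContinuousOn.mul (by fun_prop) ((continuousOn_rayKernel hc).mono
      (fun T hT => ⟨hT.1, hT.2.trans_lt hR1⟩))
  have := intervalIntegral.sub_le_integral_of_hasDeriv_right_of_le hR0
    (fun T hT => (hder T hT).continuousAt.continuousWithinAt)
    (fun T hT => (hder T (Ioo_subset_Icc_self hT)).hasDerivWithinAt)
    (hcont.integrableOn_Icc)
    (fun T hT => hle T (Ioo_subset_Icc_self hT))
  have hX0 : X 0 = 0 := by simp [hX, rayGap, rayPrim]
  have hXR : X R = 0 := by simp [hX]
  linarith

/-! ### Integration against decreasing convex weights. -/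

/-- `f` is nonnegative, nonincreasing and convex on `(0,1)`, with derivatives `f'` and `f''`. -/
structure IsDecConvex (f f' f'' : ℝ → ℝ) : Prop where
  hasDerivAt : ∀ t ∈ Ioo (0 : ℝ) 1, HasDerivAt f (f' t) t
  hasDerivAt' : ∀ t ∈ Ioo (0 : ℝ) 1, HasDerivAt f' (f'' t) t
  nonneg : ∀ t ∈ Ioo (0 : ℝ) 1, 0 ≤ f t
  nonpos : ∀ t ∈ Ioo (0 : ℝ) 1, f' t ≤ 0
  nonneg' : ∀ t ∈ Ioo (0 : ℝ) 1, 0 ≤ f'' t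

/-- The cross term 2f'g' in the second derivative is a product of two nonpositive factors. -/
lemma IsDecConvex.mul {f f' f'' g g' g'' : ℝ → ℝ} (hf : IsDecConvex f f' f'')
    (hg : IsDecConvex g g' g'') :
    IsDecConvex (fun t => f t * g t) (fun t => f' t * g t + f t * g' t)
      (fun t => f'' t * g t + 2 * (f' t * g' t) + f t * g'' t) where
  hasDerivAt t ht := (hf.hasDerivAt t ht).mul (hg.hasDerivAt t ht)
  hasDerivAt' t ht := (((hf.hasDerivAt' t ht).mul (hg.hasDerivAt t ht)).add
    ((hf.hasDerivAt t ht).mul (hg.hasDerivAt' t ht))).congr_deriv (by ring)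
  nonneg t ht := mul_nonneg (hf.nonneg t ht) (hg.nonneg t ht)
  nonpos t ht := add_nonpos (mul_nonpos_of_nonpos_of_nonneg (hf.nonpos t ht) (hg.nonneg t ht))
    (mul_nonpos_of_nonneg_of_nonpos (hf.nonneg t ht) (hg.nonpos t ht))
  nonneg' t ht := add_nonneg (add_nonneg (mul_nonneg (hf.nonneg' t ht) (hg.nonneg t ht))
    (mul_nonneg zero_le_two (mul_nonneg_of_nonpos_of_nonpos (hf.nonpos t ht) (hg.nonpos t ht))))
    (mul_nonneg (hf.nonneg t ht) (hg.nonneg' t ht))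

section Convex

variable {f f' f'' : ℝ → ℝ}

lemma IsDecConvex.antitoneOn (hf : IsDecConvex f f' f'') : AntitoneOn f (Ioo 0 1) :=
  antitoneOn_of_deriv_nonpos (convex_Ioo 0 1)
    (fun t ht => (hf.hasDerivAt t ht).continuousAt.continuousWithinAt)
    (fun t ht => (hf.hasDerivAt t (interior_subset ht)).differentiableAt.differentiableWithinAt)
    (fun t ht => by
      rw [(hf.hasDerivAt t (interior_subset ht)).deriv]
      exact hf.nonpos t (interior_subset ht))

lemma IsDecConvex.monotoneOn (hf : IsDecConvex f f' f'') : MonotoneOn f' (Ioo 0 1) :=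
  monotoneOn_of_deriv_nonneg (convex_Ioo 0 1)
    (fun t ht => (hf.hasDerivAt' t ht).continuousAt.continuousWithinAt)
    (fun t ht => (hf.hasDerivAt' t (interior_subset ht)).differentiableAt.differentiableWithinAt)
    (fun t ht => by
      rw [(hf.hasDerivAt' t (interior_subset ht)).deriv]
      exact hf.nonneg' t (interior_subset ht))

lemma IsDecConvex.mul_le_integral (hf : IsDecConvex f f' f'')
    (hint : IntervalIntegrable f volume 0 1) {t : ℝ} (ht : t ∈ Ioo (0 : ℝ) 1) :
    t * f t ≤ ∫ s in (0 : ℝ)..t, f s := by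
  have h1 : IntervalIntegrable f volume 0 t :=
    hint.mono_set (by rw [uIcc_of_le ht.1.le, uIcc_of_le zero_le_one]; exact Icc_subset_Icc_right ht.2.le)
  have h2 : ∫ _ in (0 : ℝ)..t, f t = t * f t := by simp
  rw [← h2]
  refine intervalIntegral.integral_mono_on_of_le_Ioo ht.1.le (by simp) h1 ?_
  intro s hs
  exact hf.antitoneOn ⟨hs.1, hs.2.trans ht.2⟩ ht hs.2.le

/-- The mean slope on [t/2, t] is at most f'(t) by convexity, and f(t) ≥ 0 can be dropped. -/
lemma IsDecConvex.neg_deriv_le (hf : IsDecConvex f f' f'') {t : ℝ} (ht : t ∈ Ioo (0 : ℝ) 1) :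
    -f' t * (t / 2) ≤ f (t / 2) := by
  have ht2 : t / 2 < t := by linarith [ht.1]
  have hsub : ∀ s ∈ Icc (t / 2) t, s ∈ Ioo (0 : ℝ) 1 := fun s hs =>
    ⟨by linarith [hs.1, ht.1], by linarith [hs.2, ht.2]⟩
  obtain ⟨x, hx, hxe⟩ := exists_hasDerivAt_eq_slope f f' ht2
    (fun s hs => (hf.hasDerivAt s (hsub s hs)).continuousAt.continuousWithinAt)
    (fun s hs => hf.hasDerivAt s (hsub s (Ioo_subset_Icc_self hs)))
  have h1 := hf.monotoneOn (hsub x (Ioo_subset_Icc_self hx)) ht hx.2.le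
  have h2 := hf.nonneg t ht
  have h3 : 0 < t / 2 := by linarith [ht.1]
  rw [hxe, div_le_iff₀ (by linarith)] at h1
  linarith

lemma IsDecConvex.tendsto_mul_zero (hf : IsDecConvex f f' f'')
    (hint : IntervalIntegrable f volume 0 1) :
    Tendsto (fun t => t * f t) (𝓝[>] 0) (𝓝 0) := by
  have hmem : Ioo (0 : ℝ) 1 ∈ 𝓝[>] (0 : ℝ) := Ioo_mem_nhdsGT zero_lt_one
  have hcont := intervalIntegral.continuousOn_primitive_interval' hint left_mem_uIcc
  have h0 : Tendsto (fun t => ∫ s in (0 : ℝ)..t, f s) (𝓝[>] 0) (𝓝 0) := by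
    have h := (hcont 0 left_mem_uIcc).tendsto
    rw [intervalIntegral.integral_same, uIcc_of_le zero_le_one] at h
    refine h.mono_left ?_
    rw [← nhdsWithin_Ioo_eq_nhdsGT (zero_lt_one' ℝ)]
    exact nhdsWithin_mono _ Ioo_subset_Icc_self
  refine tendsto_of_tendsto_of_tendsto_of_le_of_le' tendsto_const_nhds h0 ?_ ?_
  · filter_upwards [hmem] with t ht using mul_nonneg ht.1.le (hf.nonneg t ht)
  · filter_upwards [hmem] with t ht using hf.mul_le_integral hint ht

/-- The bound t²|f'(t)| ≤ 4·(t/2)f(t/2) reduces this to the decay of s·f(s), which integrability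
supplies. It kills a boundary term at 0 in the double integration by parts. -/
lemma IsDecConvex.tendsto_sq_mul_deriv_zero (hf : IsDecConvex f f' f'')
    (hint : IntervalIntegrable f volume 0 1) :
    Tendsto (fun t => t ^ 2 * f' t) (𝓝[>] 0) (𝓝 0) := by
  have hmem : Ioo (0 : ℝ) 1 ∈ 𝓝[>] (0 : ℝ) := Ioo_mem_nhdsGT zero_lt_one
  have hhalf : Tendsto (fun t : ℝ => t / 2) (𝓝[>] 0) (𝓝[>] 0) := by
    refine tendsto_nhdsWithin_iff.2 ⟨?_, ?_⟩
    · have : Tendsto (fun t : ℝ => t / 2) (𝓝 0) (𝓝 (0 / 2)) := tendsto_id.div_const 2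
      rw [zero_div] at this
      exact this.mono_left nhdsWithin_le_nhds
    · filter_upwards [self_mem_nhdsWithin] with t ht
      exact half_pos (mem_Ioi.1 ht)
  have h0 := ((hf.tendsto_mul_zero hint).comp hhalf).const_mul (-4)
  rw [mul_zero] at h0
  refine tendsto_of_tendsto_of_tendsto_of_le_of_le' h0 tendsto_const_nhds ?_ ?_
  · filter_upwards [hmem] with t ht
    have h1 := mul_le_mul_of_nonneg_left (hf.neg_deriv_le ht) ht.1.le
    simp only [Function.comp]
    nlinarith
  · filter_upwards [hmem] with t ht using mul_nonpos_of_nonneg_of_nonpos (sq_nonneg t) (hf.nonpos t ht)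

lemma integral_integral_eq {g : ℝ → ℝ} (hg : Continuous g) (c : ℝ) :
    ∫ s in (0 : ℝ)..c, ∫ t in (0 : ℝ)..s, g t = ∫ t in (0 : ℝ)..c, (c - t) * g t := by
  have hd : ∀ s, HasDerivAt (fun s => ∫ t in (0 : ℝ)..s, g t) (g s) s := fun s =>
    intervalIntegral.integral_hasDerivAt_right (hg.intervalIntegrable _ _)
      hg.aestronglyMeasurable.stronglyMeasurableAtFilter hg.continuousAt
  have hc : ∀ s, HasDerivAt (fun s : ℝ => c - s) (-1) s := fun s => by
    simpa using (hasDerivAt_id s).const_sub c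
  have := intervalIntegral.integral_mul_deriv_eq_deriv_mul (a := 0) (b := c)
    (fun s _ => hc s) (fun s _ => hd s) (by simp) (hg.intervalIntegrable _ _)
  rw [this]
  simp

/-- Integration against a decreasing convex weight that vanishes at `1` is controlled by
integration against the weights `(c - t)₊`. -/
theorem IsDecConvex.integral_mul_nonneg (hf : IsDecConvex f f' f'')
    (hint : IntervalIntegrable f volume 0 1) (hlim : Tendsto f (𝓝[<] 1) (𝓝 0))
    {g : ℝ → ℝ} (hg : Continuous g)
    (hc : ∀ c ∈ Ioo (0 : ℝ) 1, 0 ≤ ∫ t in (0 : ℝ)..c, (c - t) * g t) :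
    0 ≤ ∫ t in (0 : ℝ)..1, f t * g t := by
  set G : ℝ → ℝ := fun s => ∫ t in (0 : ℝ)..s, g t with hG
  set H : ℝ → ℝ := fun c => ∫ s in (0 : ℝ)..c, G s with hH
  have hGd : ∀ s, HasDerivAt G (g s) s := fun s =>
    intervalIntegral.integral_hasDerivAt_right (hg.intervalIntegrable _ _)
      hg.aestronglyMeasurable.stronglyMeasurableAtFilter hg.continuousAt
  have hGc : Continuous G := continuous_iff_continuousAt.2 fun s => (hGd s).continuousAt
  have hHd : ∀ s, HasDerivAt H (G s) s := fun s =>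
    intervalIntegral.integral_hasDerivAt_right (hGc.intervalIntegrable _ _)
      hGc.aestronglyMeasurable.stronglyMeasurableAtFilter hGc.continuousAt
  have hH0 : ∀ c ∈ Ioo (0 : ℝ) 1, 0 ≤ H c := fun c hcm => by
    rw [hH]; simp only [hG]; rw [integral_integral_eq hg]; exact hc c hcm
  have hfg : IntervalIntegrable (fun t => f t * g t) volume 0 1 :=
    hint.mul_continuousOn hg.continuousOn
  set I : ℝ → ℝ := fun t => ∫ s in (0 : ℝ)..t, f s * g s with hI
  have hfgc : ContinuousOn (fun t => f t * g t) (Ioo 0 1) := fun t ht =>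
    ((hf.hasDerivAt t ht).continuousAt.mul hg.continuousAt).continuousWithinAt
  have hId : ∀ t ∈ Ioo (0 : ℝ) 1, HasDerivAt I (f t * g t) t := fun t ht => by
    refine intervalIntegral.integral_hasDerivAt_right (hfg.mono_set ?_)
      (hfgc.stronglyMeasurableAtFilter isOpen_Ioo t ht)
      ((hf.hasDerivAt t ht).continuousAt.mul hg.continuousAt)
    rw [uIcc_of_le ht.1.le, uIcc_of_le zero_le_one]
    exact Icc_subset_Icc_right ht.2.le
  -- Double integration by parts in differential form: with H'' = g, the derivative of fG - f'H -
  -- ∫fg is -f''H ≤ 0.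
  have hXd : ∀ t ∈ Ioo (0 : ℝ) 1, HasDerivAt (fun t => f t * G t - f' t * H t - I t)
      (-(f'' t * H t)) t := fun t ht =>
    ((((hf.hasDerivAt t ht).mul (hGd t)).sub ((hf.hasDerivAt' t ht).mul (hHd t))).sub
      (hId t ht)).congr_deriv (by ring)
  have hanti : AntitoneOn (fun t => f t * G t - f' t * H t - I t) (Ioo 0 1) :=
    antitoneOn_of_deriv_nonpos (convex_Ioo 0 1)
      (fun t ht => (hXd t ht).continuousAt.continuousWithinAt)
      (fun t ht => (hXd t (interior_subset ht)).differentiableAt.differentiableWithinAt)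
      (fun t ht => by
        have ht' := interior_subset ht
        rw [(hXd t ht').deriv]
        exact neg_nonpos.2 (mul_nonneg (hf.nonneg' t ht') (hH0 t ht')))
  obtain ⟨M, hM⟩ := isCompact_Icc.exists_bound_of_continuousOn (hg.continuousOn (s := Icc 0 1))
  have hGb : ∀ t ∈ Icc (0 : ℝ) 1, ‖G t‖ ≤ M * t := fun t ht => by
    have := intervalIntegral.norm_integral_le_of_norm_le_const (a := 0) (b := t) (f := g) (C := M)
      (fun s hs => by
        rw [uIoc_of_le ht.1] at hs
        exact hM s ⟨hs.1.le, hs.2.trans ht.2⟩)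
    rwa [sub_zero, abs_of_nonneg ht.1] at this
  have hM0 : 0 ≤ M := (norm_nonneg _).trans (hM 0 ⟨le_rfl, zero_le_one⟩)
  have hHb : ∀ t ∈ Icc (0 : ℝ) 1, ‖H t‖ ≤ M * t * t := fun t ht => by
    have := intervalIntegral.norm_integral_le_of_norm_le_const (a := 0) (b := t) (f := G)
      (C := M * t) (fun s hs => by
        rw [uIoc_of_le ht.1] at hs
        exact (hGb s ⟨hs.1.le, hs.2.trans ht.2⟩).trans (mul_le_mul_of_nonneg_left hs.2 hM0))
    rwa [sub_zero, abs_of_nonneg ht.1] at this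
  have hmem : Ioo (0 : ℝ) (1 / 2) ∈ 𝓝[>] (0 : ℝ) := Ioo_mem_nhdsGT (by norm_num)
  have hrefl : Tendsto (fun t : ℝ => 1 - t) (𝓝[>] 0) (𝓝[<] 1) := by
    refine tendsto_nhdsWithin_iff.2 ⟨?_, ?_⟩
    · have : Tendsto (fun t : ℝ => 1 - t) (𝓝 0) (𝓝 (1 - 0)) := tendsto_const_nhds.sub tendsto_id
      rw [sub_zero] at this
      exact this.mono_left nhdsWithin_le_nhds
    · filter_upwards [self_mem_nhdsWithin] with t ht
      exact sub_lt_self (1 : ℝ) (mem_Ioi.1 ht)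
  have hfG1 : Tendsto (fun t => f (1 - t) * G (1 - t)) (𝓝[>] 0) (𝓝 0) := by
    have h1 := hlim.comp hrefl
    have h2 : Tendsto (fun t => G (1 - t)) (𝓝[>] 0) (𝓝 (G 1)) :=
      (hGc.tendsto 1).comp (hrefl.mono_right nhdsWithin_le_nhds)
    simpa using h1.mul h2
  have hfG0 : Tendsto (fun t => f t * G t) (𝓝[>] 0) (𝓝 0) := by
    have h1 := (hf.tendsto_mul_zero hint).const_mul M
    rw [mul_zero] at h1
    refine squeeze_zero_norm' ?_ h1
    filter_upwards [hmem] with t ht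
    have ht1 : t ∈ Ioo (0 : ℝ) 1 := ⟨ht.1, by linarith [ht.2]⟩
    rw [norm_mul, Real.norm_of_nonneg (hf.nonneg t ht1)]
    calc f t * ‖G t‖ ≤ f t * (M * t) :=
          mul_le_mul_of_nonneg_left (hGb t (Ioo_subset_Icc_self ht1)) (hf.nonneg t ht1)
      _ = M * (t * f t) := by ring
  have hfH0 : Tendsto (fun t => f' t * H t) (𝓝[>] 0) (𝓝 0) := by
    have h1 := (hf.tendsto_sq_mul_deriv_zero hint).const_mul (-M)
    rw [mul_zero] at h1
    refine squeeze_zero_norm' ?_ h1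
    filter_upwards [hmem] with t ht
    have ht1 : t ∈ Ioo (0 : ℝ) 1 := ⟨ht.1, by linarith [ht.2]⟩
    rw [norm_mul, Real.norm_of_nonpos (hf.nonpos t ht1)]
    calc -f' t * ‖H t‖ ≤ -f' t * (M * t * t) :=
          mul_le_mul_of_nonneg_left (hHb t (Ioo_subset_Icc_self ht1)) (neg_nonneg.2 (hf.nonpos t ht1))
      _ = -M * (t ^ 2 * f' t) := by ring
  have hIc := intervalIntegral.continuousOn_primitive_interval' hfg left_mem_uIcc
  rw [uIcc_of_le zero_le_one] at hIc
  have hI0 : Tendsto I (𝓝[>] 0) (𝓝 0) := by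
    have h := (hIc 0 ⟨le_rfl, zero_le_one⟩).tendsto
    rw [intervalIntegral.integral_same] at h
    refine h.mono_left ?_
    rw [← nhdsWithin_Ioo_eq_nhdsGT (zero_lt_one' ℝ)]
    exact nhdsWithin_mono _ Ioo_subset_Icc_self
  have hI1 : Tendsto (fun t => I (1 - t)) (𝓝[>] 0) (𝓝 (I 1)) := by
    have h := (hIc 1 ⟨zero_le_one, le_rfl⟩).tendsto
    refine Tendsto.comp (h.mono_left ?_) hrefl
    rw [← nhdsWithin_Ioo_eq_nhdsLT (zero_lt_one' ℝ)]
    exact nhdsWithin_mono _ Ioo_subset_Icc_self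
  have hL := hI1.sub hI0
  have hR := (hfG1.sub hfG0).add hfH0
  rw [sub_zero] at hL
  rw [sub_zero, add_zero] at hR
  refine le_of_tendsto_of_tendsto hR hL ?_
  filter_upwards [hmem] with t ht
  have ht1 : t ∈ Ioo (0 : ℝ) 1 := ⟨ht.1, by linarith [ht.2]⟩
  have ht2 : 1 - t ∈ Ioo (0 : ℝ) 1 := ⟨by linarith [ht.2], by linarith [ht.1]⟩
  have h := hanti ht1 ht2 (by linarith [ht.2])
  -- The boundary term -f'H at 1-t need not tend to 0, but it has the favourable sign and is
  -- discarded.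
  have h3 := mul_nonneg (neg_nonneg.2 (hf.nonpos _ ht2)) (hH0 _ ht2)
  simp only at h
  linarith

theorem IsDecConvex.integral_mul_nonneg_of_continuousOn (hf : IsDecConvex f f' f'')
    (hint : IntervalIntegrable f volume 0 1) (hlim : Tendsto f (𝓝[<] 1) (𝓝 0))
    {g : ℝ → ℝ} (hg : ContinuousOn g (Icc 0 1))
    (hc : ∀ c ∈ Ioo (0 : ℝ) 1, 0 ≤ ∫ t in (0 : ℝ)..c, (c - t) * g t) :
    0 ≤ ∫ t in (0 : ℝ)..1, f t * g t := by
  have hcont : Continuous (IccExtend (zero_le_one' ℝ) ((Icc 0 1).domRestrict g)) :=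
    (continuousOn_iff_continuous_domRestrict.1 hg).Icc_extend'
  have heq : ∀ t ∈ Icc (0 : ℝ) 1, IccExtend (zero_le_one' ℝ) ((Icc 0 1).domRestrict g) t = g t :=
    fun t ht => by rw [IccExtend_of_mem _ _ ht, domRestrict_apply]
  have := hf.integral_mul_nonneg hint hlim hcont (fun c hcm => by
    refine (hc c hcm).trans_eq (intervalIntegral.integral_congr fun t ht => ?_)
    rw [uIcc_of_le hcm.1.le] at ht
    rw [heq t ⟨ht.1, ht.2.trans hcm.2.le⟩])
  refine this.trans_eq (intervalIntegral.integral_congr fun t ht => ?_)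
  rw [uIcc_of_le zero_le_one] at ht
  rw [← heq t ht]

end Convex

/-! ### The weight λ is decreasing and convex, with limit 0 at 1. -/

lemma isDecConvex_rpow {a : ℝ} (ha : a ≤ 0) :
    IsDecConvex (fun t => t ^ a) (fun t => a * t ^ (a - 1))
      (fun t => a * ((a - 1) * t ^ (a - 1 - 1))) where
  hasDerivAt t ht := Real.hasDerivAt_rpow_const (Or.inl ht.1.ne')
  hasDerivAt' t ht := (Real.hasDerivAt_rpow_const (Or.inl ht.1.ne')).const_mul a
  nonneg t ht := Real.rpow_nonneg ht.1.le _
  nonpos t ht := mul_nonpos_of_nonpos_of_nonneg ha (Real.rpow_nonneg ht.1.le _)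
  nonneg' t ht := mul_nonneg_of_nonpos_of_nonpos ha
    (mul_nonpos_of_nonpos_of_nonneg (by linarith) (Real.rpow_nonneg ht.1.le _))

lemma isDecConvex_comp_one_sub {f f' f'' : ℝ → ℝ}
    (h1 : ∀ t ∈ Ioo (0 : ℝ) 1, HasDerivAt f (f' t) t)
    (h2 : ∀ t ∈ Ioo (0 : ℝ) 1, HasDerivAt f' (f'' t) t)
    (h3 : ∀ t ∈ Ioo (0 : ℝ) 1, 0 ≤ f t) (h4 : ∀ t ∈ Ioo (0 : ℝ) 1, 0 ≤ f' t)
    (h5 : ∀ t ∈ Ioo (0 : ℝ) 1, 0 ≤ f'' t) :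
    IsDecConvex (fun t => f (1 - t)) (fun t => -f' (1 - t)) (fun t => f'' (1 - t)) := by
  have hm : ∀ t ∈ Ioo (0 : ℝ) 1, 1 - t ∈ Ioo (0 : ℝ) 1 := fun t ht =>
    ⟨by linarith [ht.2], by linarith [ht.1]⟩
  have hs : ∀ t : ℝ, HasDerivAt (fun t : ℝ => 1 - t) (-1) t := fun t => by
    simpa using (hasDerivAt_id t).const_sub 1
  exact
  { hasDerivAt := fun t ht => ((h1 _ (hm t ht)).comp t (hs t)).congr_deriv (by ring)
    hasDerivAt' := fun t ht => ((h2 _ (hm t ht)).comp t (hs t)).neg.congr_deriv (by ring)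
    nonneg := fun t ht => h3 _ (hm t ht)
    nonpos := fun t ht => neg_nonpos.2 (h4 _ (hm t ht))
    nonneg' := fun t ht => h5 _ (hm t ht) }

/-- Each factor is decreasing and convex: t^(B-1) because B ≤ 1, (1-t)^(C-A-B) because its exponent
is at least 1, and φ(1-t) because φ is increasing and convex. -/
lemma isDecConvex_weight {k A B C : ℝ} {φ : ℝ → ℝ} (hk : 0 ≤ k) (hB1 : B ≤ 1)
    (hB : B ≤ C - A - 1) (hφ : IsHypergeometricFactor φ) :
    ∃ f' f'', IsDecConvex (weight k A B C φ) f' f'' := by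
  have hcd := (contDiffOn_succ_iff_deriv_of_isOpen (n := 1) isOpen_Ioo).1 hφ.contDiff
  have e1 := isDecConvex_rpow (a := B - 1) (by linarith)
  have e2 : IsDecConvex (fun t => (1 - t) ^ (C - A - B)) _ _ := isDecConvex_comp_one_sub
    (f := fun t => t ^ (C - A - B)) (f' := fun t => (C - A - B) * t ^ (C - A - B - 1))
    (f'' := fun t => (C - A - B) * ((C - A - B - 1) * t ^ (C - A - B - 1 - 1)))
    (fun t ht => Real.hasDerivAt_rpow_const (Or.inl ht.1.ne'))
    (fun t ht => (Real.hasDerivAt_rpow_const (Or.inl ht.1.ne')).const_mul _)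
    (fun t ht => Real.rpow_nonneg ht.1.le _)
    (fun t ht => mul_nonneg (by linarith) (Real.rpow_nonneg ht.1.le _))
    (fun t ht => mul_nonneg (by linarith) (mul_nonneg (by linarith) (Real.rpow_nonneg ht.1.le _)))
  have e3 : IsDecConvex (fun t => φ (1 - t)) _ _ := isDecConvex_comp_one_sub
    (f' := deriv φ) (f'' := deriv (deriv φ))
    (fun t ht => (hcd.1.differentiableAt (isOpen_Ioo.mem_nhds ht)).hasDerivAt)
    (fun t ht => (((hcd.2.2.differentiableOn one_ne_zero).differentiableAt
      (isOpen_Ioo.mem_nhds ht))).hasDerivAt)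
    (fun t ht => (hφ.pos t ht).le) hφ.deriv_nonneg hφ.deriv_deriv_nonneg
  have e0 : IsDecConvex (fun _ => k) (fun _ => 0) (fun _ => 0) :=
    ⟨fun t _ => hasDerivAt_const t k, fun t _ => hasDerivAt_const t 0, fun _ _ => hk,
      fun _ _ => le_rfl, fun _ _ => le_rfl⟩
  exact ⟨_, _, ((e0.mul e1).mul e2).mul e3⟩

lemma weight_const_pos {k A B C : ℝ} {φ : ℝ → ℝ} (hφ : IsHypergeometricFactor φ)
    (hnorm : ∫ t in (0 : ℝ)..1, weight k A B C φ t = 1) : 0 < k := by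
  by_contra! hk
  have : ∫ t in (0 : ℝ)..1, -weight k A B C φ t ≥ 0 := by
    refine intervalIntegral.integral_nonneg_of_ae_restrict zero_le_one ?_
    rw [← restrict_Ioo_eq_restrict_Icc]
    filter_upwards [ae_restrict_mem measurableSet_Ioo] with t ht
    have h1 : 0 ≤ t ^ (B - 1) * (1 - t) ^ (C - A - B) * φ (1 - t) :=
      mul_nonneg (mul_nonneg (Real.rpow_nonneg ht.1.le _) (Real.rpow_nonneg (by linarith [ht.2]) _))
        (hφ.pos _ ⟨by linarith [ht.2], by linarith [ht.1]⟩).le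
    have h2 := mul_nonneg (neg_nonneg.2 hk) h1
    simp only [weight, Pi.zero_apply]
    linarith
  rw [intervalIntegral.integral_neg, hnorm] at this
  linarith

/-- The power of 1-t has positive exponent, while monotonicity gives φ(1-t) ≤ φ(1/2) for t > 1/2. -/
lemma tendsto_weight_one {k A B C : ℝ} {φ : ℝ → ℝ} (hk : 0 ≤ k) (hB1 : B ≤ 1)
    (hB : B ≤ C - A - 1) (hφ : IsHypergeometricFactor φ) :
    Tendsto (weight k A B C φ) (𝓝[<] 1) (𝓝 0) := by
  obtain ⟨f', f'', hf⟩ := isDecConvex_weight hk hB1 hB hφ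
  have hmono : MonotoneOn φ (Ioo 0 1) :=
    monotoneOn_of_deriv_nonneg (convex_Ioo 0 1) hφ.contDiff.continuousOn
      ((hφ.contDiff.differentiableOn two_ne_zero).mono interior_subset)
      (fun t ht => hφ.deriv_nonneg t (interior_subset ht))
  have hlim : Tendsto (fun t : ℝ => k * t ^ (B - 1) * (1 - t) ^ (C - A - B) * φ (1 / 2)) (𝓝[<] 1)
      (𝓝 0) := by
    have h1 : ContinuousAt (fun t : ℝ => k * t ^ (B - 1) * (1 - t) ^ (C - A - B) * φ (1 / 2)) 1 := by
      refine ((continuousAt_const.mul (Real.continuousAt_rpow_const _ _ (Or.inl one_ne_zero))).mul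
        (ContinuousAt.rpow_const (by fun_prop) (Or.inr (by linarith)))).mul continuousAt_const
    have h2 := h1.tendsto
    simp only [sub_self] at h2
    rw [Real.zero_rpow (by linarith), mul_zero, zero_mul] at h2
    exact h2.mono_left nhdsWithin_le_nhds
  have hmem : Ioo (1 / 2 : ℝ) 1 ∈ 𝓝[<] (1 : ℝ) := Ioo_mem_nhdsLT (by norm_num)
  refine tendsto_of_tendsto_of_tendsto_of_le_of_le' tendsto_const_nhds hlim ?_ ?_
  · filter_upwards [hmem] with t ht using hf.nonneg t ⟨by linarith [ht.1], ht.2⟩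
  · filter_upwards [hmem] with t ht
    have ht0 : 0 ≤ t := by linarith [ht.1]
    have ht1 : 0 ≤ 1 - t := by linarith [ht.2]
    refine mul_le_mul_of_nonneg_left (hmono ⟨by linarith [ht.2], by linarith [ht.1]⟩
      ⟨by norm_num, by norm_num⟩ (by linarith [ht.1])) ?_
    positivity

/-! ### The one-parameter inequality in the disc. -/

/-- The kernel `(1 + (w - 1) u) / (1 - u)² = ∑ (1 + n w) uⁿ`. -/
noncomputable def starKernel (w u : ℂ) : ℂ := 1 / (1 - u) + w * (1 / (1 - u) ^ 2 - 1 / (1 - u))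

lemma one_div_one_sub_ray {c b T : ℝ} (hcb : c ^ 2 + b ^ 2 = 1) (hD : 0 < rayDist c T) :
    1 / (1 - (T : ℂ) * (c + b * Complex.I)) =
      (((1 - c * T) / rayDist c T : ℝ) : ℂ) + ((b * T / rayDist c T : ℝ) : ℂ) * Complex.I := by
  have hDe : rayDist c T = (1 - c * T) ^ 2 + (b * T) ^ 2 := by
    unfold rayDist; linear_combination (-T ^ 2) * hcb
  have hD' : ((rayDist c T : ℝ) : ℂ) ≠ 0 := by exact_mod_cast hD.ne'
  have hDc : ((rayDist c T : ℝ) : ℂ) = (1 - c * T) ^ 2 + (b * T) ^ 2 := by rw [hDe]; push_cast; ring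
  have hmul : (1 - (T : ℂ) * (c + b * Complex.I)) * (1 - c * T + b * T * Complex.I)
      = rayDist c T := by
    rw [hDc]; linear_combination (-(b : ℂ) ^ 2 * T ^ 2) * Complex.I_sq
  have hne : (1 - (T : ℂ) * (c + b * Complex.I)) ≠ 0 := fun h => by
    rw [h, zero_mul] at hmul; exact hD' hmul.symm
  rw [div_eq_iff hne]
  push_cast
  field_simp
  linear_combination -hmul

lemma starKernel_ray_re {c b T : ℝ} (hcb : c ^ 2 + b ^ 2 = 1) (hT0 : 0 ≤ T) (hT1 : T < 1) (w : ℂ) :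
    (starKernel w ((T : ℂ) * (c + b * Complex.I))).re - 1 / (1 + T) ^ 2
      = rayKernel c b w.re w.im T := by
  have hc : c ^ 2 ≤ 1 := by nlinarith [sq_nonneg b]
  have hD := rayDist_pos hc hT0 hT1
  have hDe : rayDist c T = (1 - c * T) ^ 2 + (b * T) ^ 2 := by
    unfold rayDist; linear_combination (-T ^ 2) * hcb
  have h1T : 1 - T ^ 2 = 2 * (1 - c * T) - rayDist c T := by unfold rayDist; ring
  have hsq : 1 / (1 - (T : ℂ) * (c + b * Complex.I)) ^ 2
      = (1 / (1 - (T : ℂ) * (c + b * Complex.I))) ^ 2 := by rw [div_pow, one_pow]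
  unfold starKernel rayKernel
  rw [hsq, one_div_one_sub_ray hcb hD, h1T]
  simp only [Complex.add_re, Complex.mul_re, Complex.sub_re, Complex.sub_im, Complex.add_im,
    Complex.mul_im, Complex.I_re, Complex.I_im, Complex.ofReal_re, Complex.ofReal_im, pow_two]
  field_simp
  ring

/-- Weights that are nonincreasing and convex with limit `0` at `1` satisfy the
Fournier–Ruscheweyh inequality. -/
theorem IsDecConvex.integral_starKernel_nonneg {f f' f'' : ℝ → ℝ} (hf : IsDecConvex f f' f'')
    (hint : IntervalIntegrable f volume 0 1) (hlim : Tendsto f (𝓝[<] 1) (𝓝 0))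
    {u w : ℂ} (hu : ‖u‖ < 1) (hw : w.re ^ 2 + w.im ^ 2 ≤ w.re) :
    0 ≤ ∫ t in (0 : ℝ)..1, f t * ((starKernel w (t * u)).re - 1 / (1 + t * ‖u‖) ^ 2) := by
  set ρ := ‖u‖ with hρ
  have hρ0 : 0 ≤ ρ := norm_nonneg u
  set c := Real.cos u.arg
  set b := Real.sin u.arg
  have hcb : c ^ 2 + b ^ 2 = 1 := Real.cos_sq_add_sin_sq _
  have hc : c ^ 2 ≤ 1 := by nlinarith [sq_nonneg b]
  have hue : u = ρ * (c + b * Complex.I) := by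
    rw [hρ, Complex.ofReal_cos, Complex.ofReal_sin]
    exact (Complex.norm_mul_cos_add_sin_mul_I u).symm
  have hmem : ∀ t ∈ Icc (0 : ℝ) 1, ρ * t ∈ Ico (0 : ℝ) 1 := fun t ht =>
    ⟨mul_nonneg hρ0 ht.1, (mul_le_of_le_one_right hρ0 ht.2).trans_lt hu⟩
  have hg : ContinuousOn (fun t => rayKernel c b w.re w.im (ρ * t)) (Icc 0 1) :=
    (continuousOn_rayKernel hc).comp (by fun_prop) hmem
  have hmain : 0 ≤ ∫ t in (0 : ℝ)..1, f t * rayKernel c b w.re w.im (ρ * t) := by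
    refine hf.integral_mul_nonneg_of_continuousOn hint hlim hg fun d hd => ?_
    rcases hρ0.eq_or_lt with h0 | h0
    · have : rayKernel c b w.re w.im 0 = 0 := by simp [rayKernel, rayDist]
      simp [← h0, this]
    -- The substitution T = ρt turns the weight d - t into a multiple of R - T with R = ρd < 1.
    · have h1 : ∫ t in (0 : ℝ)..d, (d - t) * rayKernel c b w.re w.im (ρ * t)
          = ρ⁻¹ * (ρ⁻¹ * ∫ T in (0 : ℝ)..(ρ * d), (ρ * d - T) * rayKernel c b w.re w.im T) := by
        have h2 := intervalIntegral.integral_comp_mul_left (a := 0) (b := d)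
          (fun T => (ρ * d - T) * rayKernel c b w.re w.im T) h0.ne'
        rw [mul_zero, smul_eq_mul] at h2
        rw [← h2, ← intervalIntegral.integral_const_mul]
        refine intervalIntegral.integral_congr fun t _ => ?_
        field_simp
      rw [h1]
      have h3 := integral_rayKernel_nonneg (b := b) (p := w.re) (q := w.im) hcb hw
        (mul_nonneg hρ0 hd.1.le) (hmem d ⟨hd.1.le, hd.2.le⟩).2
      positivity
  refine hmain.trans_eq (intervalIntegral.integral_congr fun t ht => ?_)
  rw [uIcc_of_le zero_le_one] at ht
  rw [← starKernel_ray_re hcb (hmem t ht).1 (hmem t ht).2 w]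
  have : (t : ℂ) * u = ((ρ * t : ℝ) : ℂ) * (c + b * Complex.I) := by
    conv_lhs => rw [hue]
    push_cast; ring
  rw [this, mul_comm t ρ]

/-! ### Multiplicative averages and the solution q. -/

/-- The kernel `(1 + x)⁻²`, continued evenly. -/
noncomputable def koebeKernel (x : ℝ) : ℝ := 1 / (1 + |x|) ^ 2

lemma continuous_koebeKernel : Continuous koebeKernel := by
  unfold koebeKernel
  refine continuous_const.div (by fun_prop) fun x => ?_
  positivity

lemma koebeKernel_nonneg (x : ℝ) : 0 ≤ koebeKernel x := by unfold koebeKernel; positivity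

lemma koebeKernel_le_one (x : ℝ) : koebeKernel x ≤ 1 := by
  unfold koebeKernel
  rw [div_le_one (by positivity)]
  exact one_le_pow₀ (by linarith [abs_nonneg x])

lemma norm_koebeKernel_le (x : ℝ) : ‖koebeKernel x‖ ≤ 1 := by
  rw [Real.norm_of_nonneg (koebeKernel_nonneg x)]; exact koebeKernel_le_one x

lemma koebeKernel_anti {x y : ℝ} (hx : 0 ≤ x) (hxy : x ≤ y) : koebeKernel y ≤ koebeKernel x := by
  unfold koebeKernel
  rw [abs_of_nonneg hx, abs_of_nonneg (hx.trans hxy)]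
  gcongr

lemma koebeKernel_of_nonneg {x : ℝ} (hx : 0 ≤ x) : koebeKernel x = 1 / (1 + x) ^ 2 := by
  rw [koebeKernel, abs_of_nonneg hx]

/-- The multiplicative average `x ↦ ∫₀¹ ω(s) F(s x) ds`. -/
noncomputable def scaleAvg (ω F : ℝ → ℝ) (x : ℝ) : ℝ := ∫ s in (0 : ℝ)..1, ω s * F (s * x)

section scaleAvg

variable {ω F : ℝ → ℝ}

lemma continuous_scaleAvg (hω : IntervalIntegrable ω volume 0 1) (hF : Continuous F) {M : ℝ}
    (hM : ∀ x, ‖F x‖ ≤ M) : Continuous (scaleAvg ω F) := by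
  unfold scaleAvg
  refine intervalIntegral.continuous_of_dominated_interval (bound := fun s => ‖ω s‖ * M) ?_ ?_ ?_ ?_
  · intro x
    exact hω.def'.aestronglyMeasurable.mul (by fun_prop : Continuous fun s => F (s * x)).aestronglyMeasurable
  · intro x
    refine Eventually.of_forall fun s _ => ?_
    rw [norm_mul]
    exact mul_le_mul_of_nonneg_left (hM _) (norm_nonneg _)
  · exact hω.norm.mul_const M
  · exact Eventually.of_forall fun s _ => by fun_prop

lemma norm_scaleAvg_le (hω : IntervalIntegrable ω volume 0 1) {M : ℝ}
    (hM : ∀ x, ‖F x‖ ≤ M) (x : ℝ) : ‖scaleAvg ω F x‖ ≤ ∫ s in (0 : ℝ)..1, ‖ω s‖ * M := by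
  refine intervalIntegral.norm_integral_le_of_norm_le zero_le_one ?_ (hω.norm.mul_const M)
  refine Eventually.of_forall fun s _ => ?_
  rw [norm_mul]
  exact mul_le_mul_of_nonneg_left (hM _) (norm_nonneg _)

lemma integral_mul_scaleAvg_comm {lam : ℝ → ℝ} (hl : IntervalIntegrable lam volume 0 1)
    (hω : IntervalIntegrable ω volume 0 1) (hF : Continuous F) {M : ℝ} (hM : ∀ x, ‖F x‖ ≤ M) :
    ∫ t in (0 : ℝ)..1, lam t * scaleAvg ω F t = ∫ s in (0 : ℝ)..1, ω s * scaleAvg lam F s := by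
  have e1 : ∀ t, lam t * scaleAvg ω F t
      = ∫ s in Ioc (0 : ℝ) 1, lam t * (ω s * F (s * t)) := fun t => by
    rw [integral_const_mul, scaleAvg, intervalIntegral.integral_of_le zero_le_one]
  have e2 : ∀ s, ω s * scaleAvg lam F s
      = ∫ t in Ioc (0 : ℝ) 1, lam t * (ω s * F (s * t)) := fun s => by
    rw [scaleAvg, intervalIntegral.integral_of_le zero_le_one, ← integral_const_mul]
    exact integral_congr_ae (Eventually.of_forall fun t => by simp only; rw [mul_comm t s]; ring)
  rw [intervalIntegral.integral_of_le zero_le_one, intervalIntegral.integral_of_le zero_le_one]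
  simp only [e1, e2]
  refine integral_integral_swap ?_
  have h1 : Integrable (fun z : ℝ × ℝ => lam z.1 * ω z.2)
      ((volume.restrict (Ioc (0 : ℝ) 1)).prod (volume.restrict (Ioc (0 : ℝ) 1))) :=
    Integrable.mul_prod ((intervalIntegrable_iff_integrableOn_Ioc_of_le zero_le_one).1 hl)
      ((intervalIntegrable_iff_integrableOn_Ioc_of_le zero_le_one).1 hω)
  have h2 := h1.mul_bdd (g := fun z : ℝ × ℝ => F (z.2 * z.1)) (c := M)
    (by fun_prop : Continuous fun z : ℝ × ℝ => F (z.2 * z.1)).aestronglyMeasurable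
    (Eventually.of_forall fun z => hM _)
  refine h2.congr (Eventually.of_forall fun z => ?_)
  simp only [Function.uncurry]
  ring

end scaleAvg

/-- The density `(1/μ) s^(1/μ - 1)`, whose moments are `1 / (1 + n μ)`. -/
noncomputable def powDensity (μ s : ℝ) : ℝ := 1 / μ * s ^ (1 / μ - 1)

section powDensity

variable {μ : ℝ}

lemma intervalIntegrable_powDensity (hμ : 0 < μ) (a b : ℝ) :
    IntervalIntegrable (powDensity μ) volume a b :=
  (intervalIntegral.intervalIntegrable_rpow' (by have := one_div_pos.2 hμ; linarith)).const_mul _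

lemma powDensity_nonneg (hμ : 0 < μ) {s : ℝ} (hs : 0 ≤ s) : 0 ≤ powDensity μ s :=
  mul_nonneg (by positivity) (Real.rpow_nonneg hs _)

lemma integral_powDensity_mul_pow (hμ : 0 < μ) (n : ℕ) :
    ∫ s in (0 : ℝ)..1, powDensity μ s * s ^ n = 1 / (1 + μ * n) := by
  have h0 : 0 < 1 / μ := by positivity
  have hn : (0 : ℝ) ≤ n := n.cast_nonneg
  have : ∫ s in (0 : ℝ)..1, powDensity μ s * s ^ n
      = ∫ s in (0 : ℝ)..1, 1 / μ * s ^ (1 / μ - 1 + n) := by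
    refine intervalIntegral.integral_congr_ae (Eventually.of_forall fun s hs => ?_)
    rw [uIoc_of_le zero_le_one] at hs
    rw [powDensity, Real.rpow_add hs.1, Real.rpow_natCast]
    ring
  rw [this, intervalIntegral.integral_const_mul, integral_rpow (Or.inl (by linarith))]
  have h1 : 1 / μ - 1 + n + 1 = (1 + μ * n) / μ := by field_simp; ring
  rw [h1, Real.one_rpow, Real.zero_rpow (by positivity)]
  field_simp
  ring

lemma integral_powDensity (hμ : 0 < μ) : ∫ s in (0 : ℝ)..1, powDensity μ s = 1 := by
  simpa using integral_powDensity_mul_pow hμ 0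

end powDensity

/-- The inner integral of the defining equation of the convex kernel. -/
noncomputable def innerKernel (μ t : ℝ) : ℝ :=
  1 / μ * koebeKernel t + (1 - 1 / μ) * scaleAvg (powDensity μ) koebeKernel t

lemma continuous_innerKernel {μ : ℝ} (hμ : 0 < μ) : Continuous (innerKernel μ) :=
  (continuous_const.mul continuous_koebeKernel).add (continuous_const.mul (continuous_scaleAvg
    (intervalIntegrable_powDensity hμ 0 1) continuous_koebeKernel norm_koebeKernel_le))

lemma norm_innerKernel_le {μ : ℝ} (hμ : 0 < μ) : ∃ M, ∀ t, ‖innerKernel μ t‖ ≤ M := by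
  refine ⟨‖1 / μ‖ * 1 + ‖1 - 1 / μ‖ * ∫ s in (0 : ℝ)..1, ‖powDensity μ s‖ * 1,
    fun t => (norm_add_le _ _).trans (add_le_add ?_ ?_)⟩
  · rw [norm_mul]
    exact mul_le_mul_of_nonneg_left (norm_koebeKernel_le t) (norm_nonneg _)
  · rw [norm_mul]
    exact mul_le_mul_of_nonneg_left (norm_scaleAvg_le (intervalIntegrable_powDensity hμ 0 1)
      norm_koebeKernel_le t) (norm_nonneg _)

/-- With g(x) = (1+x)⁻² one has (1-x)/(1+x)³ = g + xg', and integrating the term with xg' by parts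
in s leaves a boundary value and an average of g. On moments this is (1+n)/(1+μn) = 1/μ +
(1-1/μ)/(1+μn). -/
lemma integral_eq_innerKernel {μ t : ℝ} (hμ : 0 < μ) (ht : 0 ≤ t) :
    1 / μ * ∫ s in (0 : ℝ)..1, s ^ (1 / μ - 1) * ((1 - s * t) / (1 + s * t) ^ 3)
      = innerKernel μ t := by
  have h0 : 0 < 1 / μ := by positivity
  have hpos : ∀ s : ℝ, 0 ≤ s → 0 < 1 + s * t := fun s hs => by positivity
  have hcp : ∀ (n : ℕ) (s : ℝ), ContinuousAt (fun s : ℝ => (1 + s * t) ^ n) s := fun n s => by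
    fun_prop
  have hi1 : IntervalIntegrable (fun s : ℝ => s ^ (1 / μ - 1) * (1 / (1 + s * t) ^ 2)) volume 0 1 := by
    refine (intervalIntegral.intervalIntegrable_rpow' (by linarith)).mul_continuousOn ?_
    intro s hs
    rw [uIcc_of_le zero_le_one] at hs
    exact (ContinuousAt.div (by fun_prop) (hcp 2 s)
      (pow_pos (hpos s hs.1) 2).ne').continuousWithinAt
  have hi2 : IntervalIntegrable (fun s : ℝ => s ^ (1 / μ) * (2 * t / (1 + s * t) ^ 3)) volume 0 1 := by
    refine (intervalIntegral.intervalIntegrable_rpow' (by linarith)).mul_continuousOn ?_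
    intro s hs
    rw [uIcc_of_le zero_le_one] at hs
    exact (ContinuousAt.div (by fun_prop) (hcp 3 s)
      (pow_pos (hpos s hs.1) 3).ne').continuousWithinAt
  have hFTC := intervalIntegral.integral_eq_sub_of_hasDerivAt_of_le (a := 0) (b := 1) zero_le_one
    (f := fun s : ℝ => s ^ (1 / μ) * (1 / (1 + s * t) ^ 2))
    (f' := fun s : ℝ => 1 / μ * (s ^ (1 / μ - 1) * (1 / (1 + s * t) ^ 2))
      - s ^ (1 / μ) * (2 * t / (1 + s * t) ^ 3))
    (by
      intro s hs
      refine ContinuousAt.continuousWithinAt (ContinuousAt.mul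
        (Real.continuousAt_rpow_const _ _ (Or.inr h0.le)) (ContinuousAt.div (by fun_prop)
        (hcp 2 s) (pow_pos (hpos s hs.1) 2).ne')))
    (by
      intro s hs
      have hp := hpos s hs.1.le
      have h1 : HasDerivAt (fun s : ℝ => (1 + s * t) ^ 2) (2 * (1 + s * t) * t) s := by
        have := (((hasDerivAt_id s).mul_const t).const_add 1).pow 2
        refine this.congr_deriv ?_
        norm_num
      have h2 := (Real.hasDerivAt_rpow_const (p := 1 / μ) (Or.inl hs.1.ne')).mul
        ((hasDerivAt_const s (1 : ℝ)).div h1 (pow_pos hp 2).ne')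
      refine h2.congr_deriv ?_
      simp only [Pi.div_apply]
      field_simp
      ring)
    ((hi1.const_mul _).sub hi2)
  rw [intervalIntegral.integral_sub (hi1.const_mul _) hi2, intervalIntegral.integral_const_mul,
    Real.zero_rpow h0.ne', Real.one_rpow, one_mul, zero_mul, one_mul, sub_zero] at hFTC
  have hsplit : ∫ s in (0 : ℝ)..1, s ^ (1 / μ - 1) * ((1 - s * t) / (1 + s * t) ^ 3)
      = (∫ s in (0 : ℝ)..1, s ^ (1 / μ - 1) * (1 / (1 + s * t) ^ 2))
        - ∫ s in (0 : ℝ)..1, s ^ (1 / μ) * (2 * t / (1 + s * t) ^ 3) := by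
    rw [← intervalIntegral.integral_sub hi1 hi2]
    refine intervalIntegral.integral_congr_ae (Eventually.of_forall fun s hs => ?_)
    rw [uIoc_of_le zero_le_one] at hs
    have hp := hpos s hs.1.le
    have h1 : s ^ (1 / μ) = s ^ (1 / μ - 1) * s := by
      rw [Real.rpow_sub_one hs.1.ne', div_mul_cancel₀ _ hs.1.ne']
    rw [h1]
    field_simp
    ring
  have hav : scaleAvg (powDensity μ) koebeKernel t
      = 1 / μ * ∫ s in (0 : ℝ)..1, s ^ (1 / μ - 1) * (1 / (1 + s * t) ^ 2) := by
    rw [scaleAvg, ← intervalIntegral.integral_const_mul]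
    refine intervalIntegral.integral_congr_ae (Eventually.of_forall fun s hs => ?_)
    rw [uIoc_of_le zero_le_one] at hs
    rw [koebeKernel_of_nonneg (mul_nonneg hs.1.le ht), powDensity, mul_assoc]
  rw [innerKernel, hav, koebeKernel_of_nonneg ht, hsplit]
  linear_combination (1 / μ) * hFTC

/-- Integrating the equation determines t^(1/ν)q(t) up to a constant. Continuity of q at 0 excludes
the homogeneous solution t^(-1/ν), and rescaling the integral to [0,1] cancels the power of t. -/
theorem IsConvexKernel.eq_scaleAvg {μ ν : ℝ} {q : ℝ → ℝ} (hμ : 0 < μ) (hν : 0 < ν)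
    (hq : IsConvexKernel μ ν q) {t : ℝ} (ht : t ∈ Ioo (0 : ℝ) 1) :
    q t = scaleAvg (powDensity ν) (innerKernel μ) t := by
  have h0 : 0 < 1 / ν := by positivity
  have hkc := continuous_innerKernel hμ
  have hint : ∀ a b, IntervalIntegrable (fun x => powDensity ν x * innerKernel μ x) volume a b :=
    fun a b => (intervalIntegrable_powDensity hν a b).mul_continuousOn hkc.continuousOn
  set I : ℝ → ℝ := fun x => ∫ τ in (0 : ℝ)..x, powDensity ν τ * innerKernel μ τ with hI
  have hdc : ∀ x ∈ Ioi (0 : ℝ), ContinuousAt (fun x => powDensity ν x * innerKernel μ x) x := by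
    intro x hx
    unfold powDensity
    exact (continuousAt_const.mul (Real.continuousAt_rpow_const _ _ (Or.inl (mem_Ioi.1 hx).ne'))).mul
      hkc.continuousAt
  have hId : ∀ x ∈ Ioo (0 : ℝ) 1, HasDerivAt I (powDensity ν x * innerKernel μ x) x := by
    intro x hx
    refine intervalIntegral.integral_hasDerivAt_right (hint 0 x) ?_ (hdc x hx.1)
    exact ContinuousOn.stronglyMeasurableAtFilter isOpen_Ioi
      (fun y hy => (hdc y hy).continuousWithinAt) x hx.1
  have hdiff : ∀ x ∈ Ioo (0 : ℝ) 1, HasDerivAt (fun x => x ^ (1 / ν) * q x - I x) 0 x := by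
    intro x hx
    refine ((hq.ode x hx).sub (hId x hx)).congr_deriv ?_
    rw [← integral_eq_innerKernel hμ hx.1.le, powDensity]
    generalize (∫ s in (0 : ℝ)..1, s ^ (1 / μ - 1) * ((1 - s * x) / (1 + s * x) ^ 3)) = J
    generalize x ^ (1 / ν - 1) = y
    field_simp
    ring
  have hconst : ∀ x ∈ Ioo (0 : ℝ) 1, x ^ (1 / ν) * q x - I x = t ^ (1 / ν) * q t - I t := by
    intro x hx
    exact isOpen_Ioo.is_const_of_deriv_eq_zero isPreconnected_Ioo
      (fun y hy => (hdiff y hy).differentiableAt.differentiableWithinAt)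
      (fun y hy => (hdiff y hy).deriv) hx ht
  have hIc : Continuous I := intervalIntegral.continuous_primitive hint 0
  have hlim : Tendsto (fun x => x ^ (1 / ν) * q x - I x) (𝓝[>] 0) (𝓝 0) := by
    have h1 : Tendsto (fun x : ℝ => x ^ (1 / ν)) (𝓝[>] 0) (𝓝 0) := by
      have := (Real.continuousAt_rpow_const 0 (1 / ν) (Or.inr h0.le)).tendsto
      rw [Real.zero_rpow h0.ne'] at this
      exact this.mono_left nhdsWithin_le_nhds
    have h2 : Tendsto q (𝓝[>] 0) (𝓝 (q 0)) :=
      hq.cont.tendsto.mono_left (nhdsWithin_mono _ Ioi_subset_Ici_self)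
    have h3 : Tendsto I (𝓝[>] 0) (𝓝 0) := by
      have := hIc.tendsto 0
      rw [show I 0 = 0 from intervalIntegral.integral_same] at this
      exact this.mono_left nhdsWithin_le_nhds
    simpa using (h1.mul h2).sub h3
  have hzero : t ^ (1 / ν) * q t - I t = 0 := by
    refine tendsto_nhds_unique (tendsto_const_nhds.congr' ?_) hlim
    filter_upwards [Ioo_mem_nhdsGT (zero_lt_one' ℝ)] with x hx using (hconst x hx).symm
  have hscale : I t = t ^ (1 / ν) * scaleAvg (powDensity ν) (innerKernel μ) t := by
    have h1 := intervalIntegral.integral_comp_mul_left (a := 0) (b := 1)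
      (fun τ => powDensity ν τ * innerKernel μ τ) ht.1.ne'
    rw [mul_zero, mul_one, smul_eq_mul, inv_mul_eq_div, eq_div_iff ht.1.ne'] at h1
    rw [hI]
    simp only
    rw [← h1, scaleAvg, ← intervalIntegral.integral_const_mul, ← intervalIntegral.integral_mul_const]
    refine intervalIntegral.integral_congr_ae (Eventually.of_forall fun s hs => ?_)
    rw [uIoc_of_le zero_le_one] at hs
    rw [powDensity, powDensity, Real.mul_rpow ht.1.le hs.1.le, Real.rpow_sub_one ht.1.ne',
      mul_comm s t]
    have := ht.1.ne'
    field_simp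
  have hpos : 0 < t ^ (1 / ν) := Real.rpow_pos_of_pos ht.1 _
  rw [hscale, ← mul_sub] at hzero
  have := (mul_eq_zero.1 hzero).resolve_left hpos.ne'
  linarith

/-! ### Termwise integration of power series and moments. -/

section Series

variable {𝕜 : Type*} [RCLike 𝕜] {d : ℕ → 𝕜}

lemma norm_mul_pow_le {t : ℝ} (ht : t ∈ Icc (0 : ℝ) 1) (a : 𝕜) (n : ℕ) :
    ‖a * (t : 𝕜) ^ n‖ ≤ ‖a‖ := by
  rw [norm_mul, norm_pow, RCLike.norm_ofReal, abs_of_nonneg ht.1]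
  exact mul_le_of_le_one_right (norm_nonneg _) (pow_le_one₀ ht.1 ht.2)

lemma summable_mul_pow (hd : Summable fun n => ‖d n‖) {t : ℝ} (ht : t ∈ Icc (0 : ℝ) 1) :
    Summable fun n => d n * (t : 𝕜) ^ n :=
  Summable.of_norm_bounded hd fun n => norm_mul_pow_le ht (d n) n

lemma continuousOn_tsum_mul_pow (hd : Summable fun n => ‖d n‖) :
    ContinuousOn (fun t : ℝ => ∑' n, d n * (t : 𝕜) ^ n) (Icc 0 1) :=
  continuousOn_tsum (fun n => by fun_prop) hd fun n t ht => norm_mul_pow_le ht (d n) n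

/-- Termwise integration of a power series that converges absolutely at `1`. -/
lemma hasSum_integral_mul_pow (hd : Summable fun n => ‖d n‖) {ω : ℝ → ℝ}
    (hω : IntervalIntegrable ω volume 0 1) :
    HasSum (fun n => d n * ((∫ t in (0 : ℝ)..1, ω t * t ^ n : ℝ) : 𝕜))
      (∫ t in (0 : ℝ)..1, (ω t : 𝕜) * ∑' n, d n * (t : 𝕜) ^ n) := by
  have h := intervalIntegral.hasSum_integral_of_dominated_convergence (μ := volume) (a := 0) (b := 1)
    (F := fun n t => (ω t : 𝕜) * (d n * (t : 𝕜) ^ n))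
    (f := fun t => (ω t : 𝕜) * ∑' n, d n * (t : 𝕜) ^ n)
    (fun n t => ‖ω t‖ * ‖d n‖) ?_ ?_ ?_ ?_ ?_
  · have e : ∀ n, d n * ((∫ t in (0 : ℝ)..1, ω t * t ^ n : ℝ) : 𝕜)
        = ∫ t in (0 : ℝ)..1, (ω t : 𝕜) * (d n * (t : 𝕜) ^ n) := fun n => by
      rw [intervalIntegral.integral_of_le zero_le_one, intervalIntegral.integral_of_le zero_le_one,
        ← integral_ofReal, ← integral_const_mul]
      refine integral_congr_ae (Eventually.of_forall fun t => ?_)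
      simp only [RCLike.ofReal_mul, RCLike.ofReal_pow]
      ring
    simp_rw [e]
    exact h
  · intro n
    exact (RCLike.continuous_ofReal.comp_aestronglyMeasurable hω.def'.aestronglyMeasurable).mul
      (by fun_prop : Continuous fun t : ℝ => d n * (t : 𝕜) ^ n).aestronglyMeasurable
  · intro n
    refine Eventually.of_forall fun t ht => ?_
    rw [uIoc_of_le zero_le_one] at ht
    rw [norm_mul, RCLike.norm_ofReal, Real.norm_eq_abs]
    exact mul_le_mul_of_nonneg_left (norm_mul_pow_le ⟨ht.1.le, ht.2⟩ _ n) (abs_nonneg _)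
  · exact Eventually.of_forall fun t _ => hd.mul_left _
  · simp_rw [tsum_mul_left]
    exact hω.norm.mul_const _
  · refine Eventually.of_forall fun t ht => ?_
    rw [uIoc_of_le zero_le_one] at ht
    exact (summable_mul_pow hd ⟨ht.1.le, ht.2⟩).hasSum.mul_left _

end Series

lemma hasSum_integral_mul_pow_real {d : ℕ → ℝ} (hd : Summable fun n => ‖d n‖) {ω : ℝ → ℝ}
    (hω : IntervalIntegrable ω volume 0 1) :
    HasSum (fun n => d n * ∫ t in (0 : ℝ)..1, ω t * t ^ n)
      (∫ t in (0 : ℝ)..1, ω t * ∑' n, d n * t ^ n) :=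
  hasSum_integral_mul_pow (𝕜 := ℝ) hd hω

lemma hasSum_starKernel (w : ℂ) {u : ℂ} (hu : ‖u‖ < 1) :
    HasSum (fun n : ℕ => (1 + n * w) * u ^ n) (starKernel w u) := by
  have h := (hasSum_geometric_of_norm_lt_one hu).add
    ((hasSum_coe_mul_geometric_of_norm_lt_one hu).mul_left w)
  have hne : 1 - u ≠ 0 := fun h => by
    rw [← sub_eq_zero.1 h, norm_one] at hu; exact lt_irrefl _ hu
  have e : starKernel w u = (1 - u)⁻¹ + w * (u / (1 - u) ^ 2) := by
    unfold starKernel; field_simp; ring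
  have e' : (fun n : ℕ => (1 + n * w) * u ^ n) = fun n : ℕ => u ^ n + w * (n * u ^ n) := by
    funext n; ring
  rw [e, e']
  exact h

lemma summable_norm_star_coeff {w ζ : ℂ} (hζ : ‖ζ‖ < 1) :
    Summable fun n : ℕ => ‖(1 + n * w) * ζ ^ n‖ := by
  have hζ' : ‖‖ζ‖‖ < 1 := by rwa [norm_norm]
  have h := (summable_geometric_of_norm_lt_one hζ').add
    ((hasSum_coe_mul_geometric_of_norm_lt_one hζ').summable.mul_left ‖w‖)
  refine Summable.of_nonneg_of_le (fun _ => norm_nonneg _) (fun n => ?_) h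
  rw [norm_mul, norm_pow]
  calc ‖1 + (n : ℂ) * w‖ * ‖ζ‖ ^ n ≤ (1 + n * ‖w‖) * ‖ζ‖ ^ n := by
        refine mul_le_mul_of_nonneg_right ((norm_add_le _ _).trans ?_) (by positivity)
        rw [norm_one, norm_mul, Complex.norm_natCast]
    _ = _ := by ring

/-- The moments of a weight on `(0,1)`. -/
noncomputable def moment (lam : ℝ → ℝ) (n : ℕ) : ℝ := ∫ t in (0 : ℝ)..1, lam t * t ^ n

lemma abs_moment_le {lam : ℝ → ℝ} (hl : IntervalIntegrable lam volume 0 1) (n : ℕ) :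
    |moment lam n| ≤ ∫ t in (0 : ℝ)..1, |lam t| := by
  rw [← Real.norm_eq_abs]
  refine intervalIntegral.norm_integral_le_of_norm_le zero_le_one ?_ hl.norm
  refine Eventually.of_forall fun t ht => ?_
  have := norm_mul_pow_le (𝕜 := ℝ) ⟨ht.1.le, ht.2⟩ (lam t) n
  simpa using this

/-! ### From the one-parameter bound to the kernel q. -/

section Main

variable {lam : ℝ → ℝ} {μ ν ξ : ℝ} {q : ℝ → ℝ}

/-- The series is ∫λ(t) Re h_w(trζ)dt, so the inequality in the disc applies at u = rζ. Since
(1+x)⁻² decreases, r‖ζ‖ may be replaced by r, which makes the lower bound independent of ζ. -/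
lemma scaleAvg_koebeKernel_le_tsum {f' f'' : ℝ → ℝ} (hf : IsDecConvex lam f' f'')
    (hint : IntervalIntegrable lam volume 0 1) (hlim : Tendsto lam (𝓝[<] 1) (𝓝 0))
    {ζ w : ℂ} (hζ : ‖ζ‖ < 1) (hw : w.re ^ 2 + w.im ^ 2 ≤ w.re) {r : ℝ} (hr : r ∈ Icc (0 : ℝ) 1) :
    scaleAvg lam koebeKernel r ≤ ∑' n : ℕ, ((1 + n * w) * ζ ^ n).re * moment lam n * r ^ n := by
  have hrζ : ‖(r : ℂ) * ζ‖ = r * ‖ζ‖ := by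
    rw [norm_mul, Complex.norm_real, Real.norm_of_nonneg hr.1]
  have hrζ1 : r * ‖ζ‖ ≤ r := mul_le_of_le_one_right hr.1 hζ.le
  have hrζ2 : ‖(r : ℂ) * ζ‖ < 1 := by
    rw [hrζ]
    exact (mul_le_of_le_one_left (norm_nonneg _) hr.2).trans_lt hζ
  have hsum : Summable fun n : ℕ => ‖((1 + n * w) * ((r : ℂ) * ζ) ^ n).re‖ :=
    (summable_norm_star_coeff (w := w) hrζ2).of_nonneg_of_le (fun _ => norm_nonneg _)
      fun n => Complex.abs_re_le_norm _
  have hS := hasSum_integral_mul_pow_real hsum hint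
  have hker : ∀ t ∈ Icc (0 : ℝ) 1, ∑' n : ℕ, ((1 + n * w) * ((r : ℂ) * ζ) ^ n).re * t ^ n
      = (starKernel w (t * (r * ζ))).re := by
    intro t ht
    have hu : ‖(t : ℂ) * ((r : ℂ) * ζ)‖ < 1 := by
      rw [norm_mul, Complex.norm_real, Real.norm_of_nonneg ht.1]
      exact (mul_le_of_le_one_left (norm_nonneg _) ht.2).trans_lt hrζ2
    refine HasSum.tsum_eq ?_
    have h := Complex.hasSum_re (hasSum_starKernel w hu)
    convert h using 2 with n
    rw [mul_pow (t : ℂ), ← Complex.ofReal_pow, mul_comm ((t ^ n : ℝ) : ℂ), ← mul_assoc,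
      Complex.re_mul_ofReal]
  have hpos := hf.integral_starKernel_nonneg hint hlim hrζ2 hw
  have hScont := continuousOn_tsum_mul_pow (𝕜 := ℝ) hsum
  have hiS : IntervalIntegrable (fun t => lam t * (starKernel w (t * (r * ζ))).re) volume 0 1 := by
    refine hint.mul_continuousOn ?_
    rw [uIcc_of_le zero_le_one]
    exact hScont.congr fun t ht => (hker t ht).symm
  have hik : IntervalIntegrable (fun t => lam t * (1 / (1 + t * ‖(r : ℂ) * ζ‖) ^ 2)) volume 0 1 := by
    refine hint.mul_continuousOn fun t ht => ?_
    rw [uIcc_of_le zero_le_one] at ht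
    have h1 : ContinuousAt (fun t : ℝ => (1 + t * ‖(r : ℂ) * ζ‖) ^ 2) t := by fun_prop
    refine (ContinuousAt.div (by fun_prop) h1 ?_).continuousWithinAt
    have := ht.1
    positivity
  have hik' : IntervalIntegrable (fun t => lam t * koebeKernel (t * r)) volume 0 1 :=
    hint.mul_continuousOn (continuous_koebeKernel.comp (by fun_prop)).continuousOn
  simp_rw [mul_sub] at hpos
  rw [intervalIntegral.integral_sub hiS hik, sub_nonneg] at hpos
  have hterm : ∑' n : ℕ, ((1 + n * w) * ζ ^ n).re * moment lam n * r ^ n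
      = ∫ t in (0 : ℝ)..1, lam t * (starKernel w (t * (r * ζ))).re := by
    refine Eq.trans (tsum_congr fun n => ?_) (hS.tsum_eq.trans ?_)
    · rw [mul_pow (r : ℂ), ← Complex.ofReal_pow, mul_comm ((r ^ n : ℝ) : ℂ), ← mul_assoc,
        Complex.re_mul_ofReal, moment]
      ring
    · refine intervalIntegral.integral_congr fun t ht => ?_
      rw [uIcc_of_le zero_le_one] at ht
      rw [hker t ht]
  rw [hterm]
  refine le_trans ?_ hpos
  refine intervalIntegral.integral_mono_on_of_le_Ioo zero_le_one hik' hik fun t ht => ?_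
  refine mul_le_mul_of_nonneg_left ?_ (hf.nonneg t ht)
  have h0 : 0 ≤ t * ‖(r : ℂ) * ζ‖ := mul_nonneg ht.1.le (norm_nonneg _)
  rw [← koebeKernel_of_nonneg h0]
  refine koebeKernel_anti h0 (mul_le_mul_of_nonneg_left ?_ ht.1.le)
  rw [hrζ]; exact hrζ1

/-- Passage from the scaled one-parameter bounds to the two-parameter convex kernel. -/
lemma integral_mul_convexKernel_le (hμ : 1 ≤ μ) (hν : 0 < ν) (hξ0 : 0 ≤ ξ) (hξ1 : ξ ≤ 1)
    (hq : IsConvexKernel μ ν q) (hlam : ∀ t ∈ Ioo (0 : ℝ) 1, 0 ≤ lam t)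
    (hint : IntervalIntegrable lam volume 0 1) {d : ℕ → ℝ} (hd : Summable fun n => ‖d n‖)
    (hle : ∀ r ∈ Icc (0 : ℝ) 1, scaleAvg lam koebeKernel r ≤ ∑' n, d n * r ^ n) :
    ∫ t in (0 : ℝ)..1, lam t * q t
      ≤ ∑' n : ℕ, d n * ((1 + ξ * n) / ((1 + μ * n) * (1 + ν * n))) := by
  have hμ0 : 0 < μ := by linarith
  have hiμ := intervalIntegrable_powDensity hμ0 0 1
  have hiν := intervalIntegrable_powDensity hν 0 1
  obtain ⟨M, hM⟩ := norm_innerKernel_le hμ0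
  set e := scaleAvg lam koebeKernel with he
  have hec : Continuous e := continuous_scaleAvg hint continuous_koebeKernel norm_koebeKernel_le
  have heanti : ∀ x y, 0 ≤ x → x ≤ y → e y ≤ e x := by
    intro x y hx hxy
    refine intervalIntegral.integral_mono_on_of_le_Ioo zero_le_one
      (hint.mul_continuousOn (continuous_koebeKernel.comp (by fun_prop)).continuousOn)
      (hint.mul_continuousOn (continuous_koebeKernel.comp (by fun_prop)).continuousOn)
      fun t ht => mul_le_mul_of_nonneg_left (koebeKernel_anti (mul_nonneg ht.1.le hx)
        (mul_le_mul_of_nonneg_left hxy ht.1.le)) (hlam t ht)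
  -- Fubini moves the average over the ν-density outside; the next claim does the same for the
  -- μ-density, so that only e remains.
  have h1 : ∫ t in (0 : ℝ)..1, lam t * q t
      = ∫ r in (0 : ℝ)..1, powDensity ν r * scaleAvg lam (innerKernel μ) r := by
    rw [← integral_mul_scaleAvg_comm hint hiν (continuous_innerKernel hμ0) hM,
      intervalIntegral.integral_of_le zero_le_one, intervalIntegral.integral_of_le zero_le_one,
      integral_Ioc_eq_integral_Ioo, integral_Ioc_eq_integral_Ioo]
    refine setIntegral_congr_fun measurableSet_Ioo fun t ht => ?_
    rw [hq.eq_scaleAvg hμ0 hν ht]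
  have h2 : ∀ r, scaleAvg lam (innerKernel μ) r
      = 1 / μ * e r + (1 - 1 / μ) * ∫ s in (0 : ℝ)..1, powDensity μ s * e (s * r) := by
    intro r
    have hF : Continuous fun x => koebeKernel (x * r) := continuous_koebeKernel.comp (by fun_prop)
    have h3 := integral_mul_scaleAvg_comm hint hiμ hF fun x => norm_koebeKernel_le (x * r)
    have h4 : ∀ t, scaleAvg (powDensity μ) (fun x => koebeKernel (x * r)) t
        = scaleAvg (powDensity μ) koebeKernel (t * r) := fun t => by
      simp only [scaleAvg, mul_assoc]
    have h5 : ∀ s, scaleAvg lam (fun x => koebeKernel (x * r)) s = e (s * r) := fun s => by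
      simp only [he, scaleAvg, mul_assoc]
    simp only [h4, h5] at h3
    rw [← h3, he]
    simp only [scaleAvg, innerKernel]
    rw [← intervalIntegral.integral_const_mul, ← intervalIntegral.integral_const_mul,
      ← intervalIntegral.integral_add]
    · refine intervalIntegral.integral_congr fun t _ => ?_
      ring
    · exact (hint.mul_continuousOn
        (continuous_koebeKernel.comp (by fun_prop)).continuousOn).const_mul _
    · exact (hint.mul_continuousOn ((continuous_scaleAvg hiμ continuous_koebeKernel
        norm_koebeKernel_le).comp (by fun_prop : Continuous fun t : ℝ => t * r)).continuousOn).const_mul _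
  have hξμ : ξ / μ ≤ 1 / μ := by gcongr
  have hξμ1 : ξ / μ ≤ 1 := (div_le_one hμ0).2 (hξ1.trans hμ)
  have hξμ0 : 0 ≤ ξ / μ := by positivity
  set d' : ℕ → ℝ := fun n => d n * ((1 + ξ * n) / (1 + μ * n)) with hd'
  have hd's : Summable fun n => ‖d' n‖ := by
    refine hd.of_nonneg_of_le (fun _ => norm_nonneg _) fun n => ?_
    rw [hd', norm_mul]
    refine mul_le_of_le_one_right (norm_nonneg _) ?_
    have hn : (0 : ℝ) ≤ n := n.cast_nonneg
    rw [Real.norm_of_nonneg (by positivity), div_le_one (by positivity)]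
    have := mul_le_mul_of_nonneg_right (hξ1.trans hμ) hn
    linarith
  have h6 : ∀ r ∈ Icc (0 : ℝ) 1, scaleAvg lam (innerKernel μ) r ≤ ∑' n, d' n * r ^ n := by
    intro r hr
    have hie : IntervalIntegrable (fun s => powDensity μ s * e (s * r)) volume 0 1 :=
      hiμ.mul_continuousOn (hec.comp (by fun_prop)).continuousOn
    have h7 : e r ≤ ∫ s in (0 : ℝ)..1, powDensity μ s * e (s * r) := by
      have : e r = ∫ s in (0 : ℝ)..1, powDensity μ s * e r := by
        rw [intervalIntegral.integral_mul_const, integral_powDensity hμ0, one_mul]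
      rw [this]
      exact intervalIntegral.integral_mono_on zero_le_one (hiμ.mul_const _) hie fun s hs =>
        mul_le_mul_of_nonneg_left (heanti _ _ (mul_nonneg hs.1 hr.1)
          (mul_le_of_le_one_left hr.1 hs.2)) (powDensity_nonneg hμ0 hs.1)
    have hdr : Summable fun n => ‖d n * r ^ n‖ :=
      hd.of_nonneg_of_le (fun _ => norm_nonneg _) fun n => by
        simpa using norm_mul_pow_le (𝕜 := ℝ) hr (d n) n
    have h8 := hasSum_integral_mul_pow_real hdr hiμ
    simp only [integral_powDensity_mul_pow hμ0] at h8
    have hic : ContinuousOn (fun s : ℝ => ∑' n, d n * r ^ n * s ^ n) (Icc 0 1) := by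
      simpa using continuousOn_tsum_mul_pow (𝕜 := ℝ) hdr
    have h9 : ∫ s in (0 : ℝ)..1, powDensity μ s * e (s * r)
        ≤ ∫ s in (0 : ℝ)..1, powDensity μ s * ∑' n, d n * r ^ n * s ^ n := by
      refine intervalIntegral.integral_mono_on zero_le_one hie
        (hiμ.mul_continuousOn (by rwa [uIcc_of_le zero_le_one])) fun s hs =>
        mul_le_mul_of_nonneg_left ?_ (powDensity_nonneg hμ0 hs.1)
      refine (hle (s * r) ⟨mul_nonneg hs.1 hr.1, mul_le_one₀ hs.2 hr.1 hr.2⟩).trans_eq ?_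
      exact tsum_congr fun n => by rw [mul_pow]; ring
    -- Partial fractions: (1+ξn)/(1+μn) = ξ/μ + (1-ξ/μ)/(1+μn), where 1/(1+μn) is a moment of the
    -- μ-density. Both coefficients are nonnegative since ξ ≤ 1 ≤ μ.
    have h10 : ∑' n, d' n * r ^ n = ξ / μ * ∑' n, d n * r ^ n
        + (1 - ξ / μ) * ∫ s in (0 : ℝ)..1, powDensity μ s * ∑' n, d n * r ^ n * s ^ n := by
      have hadd := (hdr.of_norm.hasSum.mul_left (ξ / μ)).add (h8.mul_left (1 - ξ / μ))
      refine Eq.trans (tsum_congr fun n => ?_) hadd.tsum_eq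
      have hn : (0 : ℝ) ≤ n := n.cast_nonneg
      simp only [hd']
      field_simp
      ring
    rw [h10, h2]
    have h11 := hle r hr
    set J := ∫ s in (0 : ℝ)..1, powDensity μ s * e (s * r)
    -- As e decreases, e(r) is at most its average J, so moving mass (1-ξ)/μ from e(r) to J
    -- increases the combination.
    have h12 : 1 / μ * e r + (1 - 1 / μ) * J ≤ ξ / μ * e r + (1 - ξ / μ) * J := by
      nlinarith
    have h13 := mul_le_mul_of_nonneg_left h11 hξμ0
    have h14 := mul_le_mul_of_nonneg_left h9 (sub_nonneg.2 hξμ1)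
    linarith
  have h15 := hasSum_integral_mul_pow_real hd's hiν
  simp only [integral_powDensity_mul_pow hν] at h15
  have h16 : ∑' n : ℕ, d n * ((1 + ξ * n) / ((1 + μ * n) * (1 + ν * n)))
      = ∫ t in (0 : ℝ)..1, powDensity ν t * ∑' n, d' n * t ^ n := by
    rw [← h15.tsum_eq]
    refine tsum_congr fun n => ?_
    have hn : (0 : ℝ) ≤ n := n.cast_nonneg
    simp only [hd']
    field_simp
  have hcd : ContinuousOn (fun t : ℝ => ∑' n, d' n * t ^ n) (Icc 0 1) := by
    simpa using continuousOn_tsum_mul_pow (𝕜 := ℝ) hd's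
  rw [h1, h16]
  refine intervalIntegral.integral_mono_on zero_le_one
    (hiν.mul_continuousOn ?_) (hiν.mul_continuousOn (by rwa [uIcc_of_le zero_le_one])) fun r hr =>
    mul_le_mul_of_nonneg_left (h6 r hr) (powDensity_nonneg hν hr.1)
  exact (continuous_scaleAvg hint (continuous_innerKernel hμ0) hM).continuousOn

end Main

/-! ### Calculus of power series on the unit disc. -/

/-- `F` is the sum of the power series with coefficients `a` on the unit disc. -/
def HasDiscSeries (a : ℕ → ℂ) (F : ℂ → ℂ) : Prop :=
  ∀ z ∈ Metric.ball (0 : ℂ) 1, HasSum (fun n => a n * z ^ n) (F z)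

section DiscSeries

variable {a b : ℕ → ℂ} {F G : ℂ → ℂ}

lemma hasDiscSeries_taylor (hF : DifferentiableOn ℂ F (Metric.ball 0 1)) :
    HasDiscSeries (fun n => iteratedDeriv n F 0 / n.factorial) F := by
  intro z hz
  have h := Complex.hasSum_taylorSeries_on_ball hF hz
  have e : (fun n : ℕ => iteratedDeriv n F 0 / n.factorial * z ^ n)
      = fun n : ℕ => (n.factorial : ℂ)⁻¹ • (z - 0) ^ n • iteratedDeriv n F 0 := by
    funext n
    rw [sub_zero, smul_eq_mul, smul_eq_mul]
    ring
  rw [e]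
  exact h

/-- Summability at each real r < 1 makes the terms there tend to 0, so the radius of convergence is
at least 1. -/
lemma HasDiscSeries.hasFPowerSeriesOnBall (h : HasDiscSeries a F) :
    HasFPowerSeriesOnBall F (FormalMultilinearSeries.ofScalars ℂ a) 0 1 where
  r_le := by
    refine ENNReal.le_of_forall_nnreal_lt fun r hr => ?_
    have hr1 : (r : ℝ) < 1 := by exact_mod_cast hr
    have hz : ((r : ℝ) : ℂ) ∈ Metric.ball (0 : ℂ) 1 := by
      rw [mem_ball_zero_iff, Complex.norm_real, NNReal.norm_eq]
      exact hr1
    refine FormalMultilinearSeries.le_radius_of_tendsto _ (l := 0) ?_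
    have h1 := (h _ hz).summable.norm.tendsto_atTop_zero
    refine h1.congr fun n => ?_
    rw [FormalMultilinearSeries.ofScalars_norm, norm_mul, norm_pow, Complex.norm_real,
      NNReal.norm_eq]
  r_pos := one_pos
  hasSum := by
    intro y hy
    have hy' : y ∈ Metric.ball (0 : ℂ) 1 := by
      rw [mem_ball_zero_iff]
      simpa [Metric.mem_eball, edist_zero_right, ← ofReal_norm] using hy
    have h1 := h y hy'
    simpa [FormalMultilinearSeries.ofScalars_apply_eq, mul_comm] using h1

lemma HasDiscSeries.differentiableOn (h : HasDiscSeries a F) :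
    DifferentiableOn ℂ F (Metric.ball 0 1) := by
  have := h.hasFPowerSeriesOnBall.differentiableOn
  rwa [← ENNReal.ofReal_one, Metric.eball_ofReal] at this

lemma HasDiscSeries.unique (ha : HasDiscSeries a F) (hb : HasDiscSeries b F) : a = b :=
  FormalMultilinearSeries.ofScalars_series_injective ℂ ℂ
    (ha.hasFPowerSeriesOnBall.hasFPowerSeriesAt.eq_formalMultilinearSeries
      hb.hasFPowerSeriesOnBall.hasFPowerSeriesAt)

lemma HasDiscSeries.deriv (h : HasDiscSeries a F) :
    HasDiscSeries (fun n => (n + 1) * a (n + 1)) (deriv F) := by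
  have h1 := hasDiscSeries_taylor (h.differentiableOn.deriv Metric.isOpen_ball)
  have h2 := h.unique (hasDiscSeries_taylor h.differentiableOn)
  have e : (fun n : ℕ => ((n : ℂ) + 1) * a (n + 1))
      = fun n : ℕ => iteratedDeriv n (_root_.deriv F) 0 / n.factorial := by
    funext n
    rw [h2]
    simp only
    rw [iteratedDeriv_succ', Nat.factorial_succ]
    have hn : (n.factorial : ℂ) ≠ 0 := by exact_mod_cast n.factorial_ne_zero
    have hn1 : (n : ℂ) + 1 ≠ 0 := by exact_mod_cast n.succ_ne_zero
    push_cast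
    field_simp
  rw [e]
  exact h1

lemma HasDiscSeries.apply_zero (h : HasDiscSeries a F) : F 0 = a 0 := by
  have h1 := (h 0 (Metric.mem_ball_self one_pos)).unique
    (hasSum_single 0 fun n hn => by rw [zero_pow hn, mul_zero])
  simpa using h1

lemma HasDiscSeries.congr (h : HasDiscSeries a F) (hab : ∀ n, b n = a n)
    (hFG : ∀ z ∈ Metric.ball (0 : ℂ) 1, G z = F z) : HasDiscSeries b G := by
  intro z hz
  rw [hFG z hz]
  simp_rw [hab]
  exact h z hz

lemma HasDiscSeries.add (ha : HasDiscSeries a F) (hb : HasDiscSeries b G) :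
    HasDiscSeries (fun n => a n + b n) (fun z => F z + G z) := fun z hz => by
  simpa only [add_mul] using (ha z hz).add (hb z hz)

lemma HasDiscSeries.const_mul (c : ℂ) (ha : HasDiscSeries a F) :
    HasDiscSeries (fun n => c * a n) (fun z => c * F z) := fun z hz => by
  simpa only [mul_assoc] using (ha z hz).mul_left c

lemma HasDiscSeries.id_mul (ha : HasDiscSeries (fun n => a (n + 1)) F) (h0 : a 0 = 0) :
    HasDiscSeries a (fun z => z * F z) := fun z hz => by
  rw [← hasSum_nat_add_iff' 1]
  have h := (ha z hz).mul_left z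
  simp only [Finset.range_one, Finset.sum_singleton, h0, zero_mul, sub_zero]
  have e : (fun n => a (n + 1) * z ^ (n + 1)) = fun n => z * (a (n + 1) * z ^ n) := by
    funext n; ring
  rw [e]
  exact h

lemma HasDiscSeries.id_mul_deriv (ha : HasDiscSeries a F) :
    HasDiscSeries (fun n => n * a n) (fun z => z * _root_.deriv F z) := by
  refine HasDiscSeries.id_mul (ha.deriv.congr (fun n => ?_) fun _ _ => rfl) (by simp)
  push_cast; rfl

lemma hasDiscSeries_const (c : ℂ) :
    HasDiscSeries (fun n => if n = 0 then c else 0) (fun _ => c) := fun z _ => by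
  have := hasSum_single (f := fun n : ℕ => (if n = 0 then c else 0) * z ^ n) 0
    (fun n hn => by simp [hn])
  simpa using this

/-- The coefficients of `F(z)/z` for `F(0) = 0`. -/
lemma HasDiscSeries.hasSum_div (ha : HasDiscSeries a F) (h0 : a 0 = 0) {z : ℂ}
    (hz : z ∈ Metric.ball (0 : ℂ) 1) (hz0 : z ≠ 0) :
    HasSum (fun n => a (n + 1) * z ^ n) (F z / z) := by
  have h := (hasSum_nat_add_iff' 1).2 (ha z hz)
  simp only [Finset.range_one, Finset.sum_singleton, h0, zero_mul, sub_zero] at h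
  have e : (fun n => a (n + 1) * z ^ n) = fun n => a (n + 1) * z ^ (n + 1) / z := by
    funext n; field_simp; ring
  rw [e]
  exact h.div_const z

lemma HasDiscSeries.dslope (ha : HasDiscSeries a F) (h0 : a 0 = 0) :
    HasDiscSeries (fun n => a (n + 1)) (dslope F 0) := fun z hz => by
  rcases eq_or_ne z 0 with rfl | hz0
  · rw [dslope_same]
    have h1 := ha.deriv.apply_zero
    rw [h1]
    have := hasSum_single (f := fun n : ℕ => a (n + 1) * (0 : ℂ) ^ n) 0
      (fun n hn => by rw [zero_pow hn, mul_zero])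
    simpa using this
  · rw [dslope_of_ne _ hz0, slope_def_field, ha.apply_zero, h0, sub_zero, sub_zero]
    exact ha.hasSum_div h0 hz hz0

end DiscSeries

/-! ### Hadamard products and half-planes. -/

section Convolution

lemma integral_exp_int (m : ℤ) :
    ∫ τ in (0 : ℝ)..2 * Real.pi, Complex.exp (m * τ * Complex.I)
      = if m = 0 then 2 * (Real.pi : ℂ) else 0 := by
  split_ifs with h
  · simp [h]
  · have hm : (m : ℂ) * Complex.I ≠ 0 := mul_ne_zero (by exact_mod_cast h) Complex.I_ne_zero
    have h1 := integral_exp_mul_complex (a := 0) (b := 2 * Real.pi) hm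
    have e : ∀ τ : ℝ, Complex.exp (m * τ * Complex.I) = Complex.exp (m * Complex.I * τ) :=
      fun τ => by congr 1; ring
    simp_rw [e]
    rw [h1]
    have e2 : (m : ℂ) * Complex.I * ((2 * Real.pi : ℝ) : ℂ) = m * (2 * Real.pi * Complex.I) := by
      push_cast; ring
    rw [e2, Complex.exp_int_mul_two_pi_mul_I]
    simp

lemma norm_exp_int (m : ℤ) (τ : ℝ) : ‖Complex.exp (m * τ * Complex.I)‖ = 1 := by
  have : (m : ℂ) * τ * Complex.I = ((m * τ : ℝ) : ℂ) * Complex.I := by push_cast; ring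
  rw [this, Complex.norm_exp_ofReal_mul_I]

lemma hasSum_integral_trig {u : ℕ → ℂ} (hu : Summable fun n => ‖u n‖) (m : ℕ → ℤ) {G : ℝ → ℂ}
    (hG : Continuous G) :
    HasSum (fun n => u n * ∫ τ in (0 : ℝ)..2 * Real.pi, Complex.exp (m n * τ * Complex.I) * G τ)
      (∫ τ in (0 : ℝ)..2 * Real.pi, (∑' n, u n * Complex.exp (m n * τ * Complex.I)) * G τ) := by
  have h := intervalIntegral.hasSum_integral_of_dominated_convergence (μ := volume) (a := 0)
    (b := 2 * Real.pi) (F := fun n τ => u n * (Complex.exp (m n * τ * Complex.I) * G τ))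
    (f := fun τ => (∑' n, u n * Complex.exp (m n * τ * Complex.I)) * G τ)
    (fun n τ => ‖u n‖ * ‖G τ‖) ?_ ?_ ?_ ?_ ?_
  · simp_rw [intervalIntegral.integral_const_mul] at h
    exact h
  · intro n
    exact (by fun_prop : Continuous fun τ : ℝ =>
      u n * (Complex.exp (m n * τ * Complex.I) * G τ)).aestronglyMeasurable
  · intro n
    refine Eventually.of_forall fun τ _ => ?_
    rw [norm_mul, norm_mul, norm_exp_int, one_mul]
  · exact Eventually.of_forall fun τ _ => hu.mul_right _
  · simp_rw [tsum_mul_right]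
    exact (hG.norm.intervalIntegrable _ _).const_mul _
  · refine Eventually.of_forall fun τ _ => ?_
    have hs : Summable fun n => u n * Complex.exp (m n * τ * Complex.I) :=
      Summable.of_norm_bounded hu fun n => by rw [norm_mul, norm_exp_int, mul_one]
    simpa only [mul_assoc] using hs.hasSum.mul_right (G τ)

variable {p k : ℕ → ℂ} {P K : ℂ → ℂ}

/-- The convolution with a function whose real part is at least `1/2` preserves half-planes. -/
theorem HasDiscSeries.convolution_re_pos (hp : HasDiscSeries p P) (hk : HasDiscSeries k K)
    (hp0 : p 0 = 1) (hk0 : k 0 = 1) {e : ℂ}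
    (hP : ∀ z ∈ Metric.ball (0 : ℂ) 1, 0 < (e * P z).re)
    (hK : ∀ z ∈ Metric.ball (0 : ℂ) 1, 1 / 2 ≤ (K z).re) {z : ℂ}
    (hz : z ∈ Metric.ball (0 : ℂ) 1) : 0 < (e * ∑' n, p n * k n * z ^ n).re := by
  rw [mem_ball_zero_iff] at hz
  -- Writing z = ρζ with both factors inside the disc makes both series absolutely summable on the
  -- circles used below. The product at z is then the mean of P(ρe^{iτ}) against the density 2 Re
  -- K(ζe^{-iτ}) - 1, which is nonnegative and has mean 1.
  obtain ⟨ρ, hzρ, hρ1⟩ := exists_between hz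
  have hρ0 : 0 < ρ := (norm_nonneg z).trans_lt hzρ
  set ζ : ℂ := z / ρ with hζ
  have hζ1 : ‖ζ‖ < 1 := by
    rw [hζ, norm_div, Complex.norm_real, Real.norm_of_nonneg hρ0.le, div_lt_one hρ0]
    exact hzρ
  have hρb : (ρ : ℂ) ∈ Metric.ball (0 : ℂ) 1 := by
    rwa [mem_ball_zero_iff, Complex.norm_real, Real.norm_of_nonneg hρ0.le]
  have hζb : ζ ∈ Metric.ball (0 : ℂ) 1 := by rwa [mem_ball_zero_iff]
  set u : ℕ → ℂ := fun n => p n * (ρ : ℂ) ^ n with hu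
  set v : ℕ → ℂ := fun n => k n * ζ ^ n with hv
  have hus : Summable fun n => ‖u n‖ := (hp _ hρb).summable.norm
  have hvs : Summable fun n => ‖v n‖ := (hk _ hζb).summable.norm
  have hcs : Summable fun n => ‖(starRingEnd ℂ) (v n)‖ := by simpa using hvs
  have hrot : ∀ (c : ℂ), ‖c‖ < 1 → ∀ (m : ℤ) (τ : ℝ),
      c * Complex.exp (m * τ * Complex.I) ∈ Metric.ball (0 : ℂ) 1 := fun c hc m τ => by
    rwa [mem_ball_zero_iff, norm_mul, norm_exp_int, mul_one]
  set U : ℝ → ℂ := fun τ => P (ρ * Complex.exp ((1 : ℤ) * τ * Complex.I)) with hU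
  set V : ℝ → ℂ := fun τ => K (ζ * Complex.exp ((-1 : ℤ) * τ * Complex.I)) with hV
  have hexp : ∀ (m : ℤ) (τ : ℝ) (n : ℕ),
      Complex.exp (m * τ * Complex.I) ^ n = Complex.exp ((m * n : ℤ) * τ * Complex.I) := by
    intro m τ n
    rw [← Complex.exp_nat_mul]
    congr 1
    push_cast
    ring
  have hUs : ∀ τ : ℝ, HasSum (fun n : ℕ => u n * Complex.exp ((n : ℤ) * τ * Complex.I)) (U τ) := by
    intro τ
    have h := hp _ (hrot ρ (by simpa using hρb) 1 τ)
    convert h using 2 with n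
    rw [mul_pow, hexp, one_mul, hu]
    ring
  have hVs : ∀ τ : ℝ, HasSum (fun n : ℕ => v n * Complex.exp ((-n : ℤ) * τ * Complex.I)) (V τ) := by
    intro τ
    have h := hk _ (hrot ζ hζ1 (-1) τ)
    convert h using 2 with n
    rw [mul_pow, hexp, neg_one_mul, hv]
    ring
  have hVc : ∀ τ : ℝ, HasSum (fun n : ℕ => (starRingEnd ℂ) (v n) * Complex.exp ((n : ℤ) * τ * Complex.I))
      ((starRingEnd ℂ) (V τ)) := by
    intro τ
    have h := (hVs τ).star
    convert h using 2 with n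
    swap
    · rfl
    change _ = (starRingEnd ℂ) (v n * Complex.exp ((-n : ℤ) * τ * Complex.I))
    rw [map_mul (starRingEnd ℂ) (v n), ← Complex.exp_conj]
    congr 2
    simp
  have hUc : Continuous U :=
    hp.differentiableOn.continuousOn.comp_continuous (by fun_prop)
      (hrot ρ (by simpa using hρb) 1)
  have hVcont : Continuous V :=
    hk.differentiableOn.continuousOn.comp_continuous (by fun_prop) (hrot ζ hζ1 (-1))
  have hπ : (0 : ℝ) < 2 * Real.pi := by positivity
  have hUm : ∀ m : ℤ, HasSum (fun n : ℕ => u n * if (n : ℤ) + m = 0 then 2 * (Real.pi : ℂ) else 0)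
      (∫ τ in (0 : ℝ)..2 * Real.pi, Complex.exp (m * τ * Complex.I) * U τ) := by
    intro m
    have h := hasSum_integral_trig hus (fun n => (n : ℤ))
      (by fun_prop : Continuous fun τ : ℝ => Complex.exp (m * τ * Complex.I))
    have e1 : ∀ n : ℕ, ∫ τ in (0 : ℝ)..2 * Real.pi, Complex.exp ((n : ℤ) * τ * Complex.I)
        * Complex.exp (m * τ * Complex.I) = if (n : ℤ) + m = 0 then 2 * (Real.pi : ℂ) else 0 := by
      intro n
      rw [← integral_exp_int]
      refine intervalIntegral.integral_congr fun τ _ => ?_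
      rw [← Complex.exp_add]
      congr 1
      push_cast
      ring
    simp_rw [e1] at h
    convert h using 1
    refine intervalIntegral.integral_congr fun τ _ => ?_
    rw [(hUs τ).tsum_eq, mul_comm]
  have hUn : ∀ n : ℕ, ∫ τ in (0 : ℝ)..2 * Real.pi, Complex.exp ((-n : ℤ) * τ * Complex.I) * U τ
      = 2 * Real.pi * u n := by
    intro n
    refine (hUm (-n)).unique ?_
    convert hasSum_single (f := fun j : ℕ => u j * if (j : ℤ) + -n = 0 then 2 * (Real.pi : ℂ) else 0) n
      (fun j hj => by
        rw [if_neg (fun h => hj (by omega)), mul_zero]) using 1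
    simp [mul_comm]
  have hUpos : ∀ n : ℕ, ∫ τ in (0 : ℝ)..2 * Real.pi, Complex.exp ((n : ℤ) * τ * Complex.I) * U τ
      = if n = 0 then 2 * (Real.pi : ℂ) else 0 := by
    intro n
    rcases eq_or_ne n 0 with rfl | hn
    · have := hUn 0
      simpa [hu, hp0] using this
    · rw [if_neg hn]
      refine (hUm n).unique ?_
      convert hasSum_zero using 2 with j
      rw [if_neg (by omega), mul_zero]
  have hA : ∫ τ in (0 : ℝ)..2 * Real.pi, V τ * U τ = 2 * Real.pi * ∑' n, p n * k n * z ^ n := by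
    have h := hasSum_integral_trig hvs (fun n => -(n : ℤ)) hUc
    simp_rw [hUn] at h
    rw [← tsum_mul_left]
    have e1 : ∫ τ in (0 : ℝ)..2 * Real.pi, V τ * U τ = ∫ τ in (0 : ℝ)..2 * Real.pi,
        (∑' n : ℕ, v n * Complex.exp ((-n : ℤ) * τ * Complex.I)) * U τ :=
      intervalIntegral.integral_congr fun τ _ => by rw [(hVs τ).tsum_eq]
    rw [e1, ← h.tsum_eq]
    refine tsum_congr fun n => ?_
    have hz' : z = ρ * ζ := by
      rw [hζ, mul_div_cancel₀]
      exact_mod_cast hρ0.ne'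
    rw [hz', mul_pow, hu, hv]
    ring
  -- Conjugation reverses the frequencies of V, so only the constant terms pair up. This
  -- contribution cancels that of -U in the density.
  have hB : ∫ τ in (0 : ℝ)..2 * Real.pi, (starRingEnd ℂ) (V τ) * U τ = 2 * Real.pi := by
    have h := hasSum_integral_trig hcs (fun n => (n : ℤ)) hUc
    simp_rw [hUpos] at h
    have e1 : ∫ τ in (0 : ℝ)..2 * Real.pi, (starRingEnd ℂ) (V τ) * U τ = ∫ τ in (0 : ℝ)..2 * Real.pi,
        (∑' n : ℕ, (starRingEnd ℂ) (v n) * Complex.exp ((n : ℤ) * τ * Complex.I)) * U τ :=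
      intervalIntegral.integral_congr fun τ _ => by rw [(hVc τ).tsum_eq]
    rw [e1]
    refine h.unique ?_
    convert hasSum_single (f := fun n : ℕ => (starRingEnd ℂ) (v n) *
      if n = 0 then 2 * (Real.pi : ℂ) else 0) 0 (fun n hn => by simp [hn]) using 1
    simp [hv, hk0]
  have hC : ∫ τ in (0 : ℝ)..2 * Real.pi, U τ = 2 * Real.pi := by simpa using hUpos 0
  have hD : ∫ τ in (0 : ℝ)..2 * Real.pi, (2 * (V τ).re - 1) = 2 * Real.pi := by
    have h := hasSum_integral_trig hvs (fun n => -(n : ℤ)) (continuous_const (y := (1 : ℂ)))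
    have e1 : ∀ n : ℕ, ∫ τ in (0 : ℝ)..2 * Real.pi,
        Complex.exp ((-(n : ℤ) : ℤ) * τ * Complex.I) * (1 : ℂ)
        = if n = 0 then 2 * (Real.pi : ℂ) else 0 := by
      intro n
      simp_rw [mul_one]
      rw [integral_exp_int]
      simp
    simp_rw [e1] at h
    have e2 : ∫ τ in (0 : ℝ)..2 * Real.pi, V τ = 2 * Real.pi := by
      have e3 : ∫ τ in (0 : ℝ)..2 * Real.pi, V τ = ∫ τ in (0 : ℝ)..2 * Real.pi,
        (∑' n : ℕ, v n * Complex.exp ((-n : ℤ) * τ * Complex.I)) * (1 : ℂ) :=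
        intervalIntegral.integral_congr fun τ _ => by rw [(hVs τ).tsum_eq, mul_one]
      rw [e3]
      refine h.unique ?_
      convert hasSum_single (f := fun n : ℕ => v n *
        if n = 0 then 2 * (Real.pi : ℂ) else 0) 0 (fun n hn => by simp [hn]) using 1
      simp [hv, hk0]
    have e4 : ∫ τ in (0 : ℝ)..2 * Real.pi, (V τ).re = 2 * Real.pi := by
      have := intervalIntegral.intervalIntegral_re (hVcont.intervalIntegrable (μ := volume) 0 (2 * Real.pi))
      simp only [RCLike.re_eq_complex_re] at this
      rw [this, e2]
      simp
    rw [intervalIntegral.integral_sub, intervalIntegral.integral_const_mul, e4]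
    · simp; ring
    · exact ((Complex.continuous_re.comp hVcont).const_smul (2 : ℝ)).intervalIntegrable _ _
    · simp
  -- A density may vanish on large sets, so strict positivity is secured by the minimum of Re(eU)
  -- over the compact circle.
  obtain ⟨τ₀, -, hmin⟩ := (isCompact_Icc (a := (0 : ℝ)) (b := 2 * Real.pi)).exists_isMinOn
    (nonempty_Icc.2 hπ.le) (f := fun τ => (e * U τ).re)
    (by fun_prop)
  set δ := (e * U τ₀).re
  have hδ : 0 < δ := hP _ (hrot ρ (by simpa using hρb) 1 τ₀)
  have hE : 2 * Real.pi * (e * ∑' n, p n * k n * z ^ n).re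
      = ∫ τ in (0 : ℝ)..2 * Real.pi, (e * U τ).re * (2 * (V τ).re - 1) := by
    have hcV : Continuous fun τ => (starRingEnd ℂ) (V τ) := Complex.continuous_conj.comp hVcont
    have h1 : ∫ τ in (0 : ℝ)..2 * Real.pi, e * (V τ * U τ + (starRingEnd ℂ) (V τ) * U τ - U τ)
        = 2 * Real.pi * (e * ∑' n, p n * k n * z ^ n) := by
      rw [intervalIntegral.integral_const_mul, intervalIntegral.integral_sub,
        intervalIntegral.integral_add, hA, hB, hC]
      · ring
      · exact (hVcont.mul hUc).intervalIntegrable _ _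
      · exact (hcV.mul hUc).intervalIntegrable _ _
      · exact ((hVcont.mul hUc).add (hcV.mul hUc)).intervalIntegrable _ _
      · exact hUc.intervalIntegrable _ _
    have hcE : Continuous fun τ => e * (V τ * U τ + (starRingEnd ℂ) (V τ) * U τ - U τ) :=
      continuous_const.mul (((hVcont.mul hUc).add (hcV.mul hUc)).sub hUc)
    have h2 := intervalIntegral.intervalIntegral_re
      (hcE.intervalIntegrable (μ := volume) 0 (2 * Real.pi))
    rw [h1] at h2
    simp only [RCLike.re_eq_complex_re] at h2
    have h3 : (2 * (Real.pi : ℂ) * (e * ∑' n, p n * k n * z ^ n)).re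
        = 2 * Real.pi * (e * ∑' n, p n * k n * z ^ n).re := by
      have : (2 * (Real.pi : ℂ)) = ((2 * Real.pi : ℝ) : ℂ) := by push_cast; ring
      rw [this, Complex.re_ofReal_mul]
    rw [← h3, ← h2]
    refine intervalIntegral.integral_congr fun τ _ => ?_
    simp only [Complex.mul_re, Complex.add_re, Complex.sub_re, Complex.add_im, Complex.sub_im,
      Complex.mul_im, Complex.conj_re, Complex.conj_im]
    ring
  have hF : δ * (2 * Real.pi) ≤ ∫ τ in (0 : ℝ)..2 * Real.pi, (e * U τ).re * (2 * (V τ).re - 1) := by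
    have hδi : δ * (2 * Real.pi) = ∫ τ in (0 : ℝ)..2 * Real.pi, δ * (2 * (V τ).re - 1) := by
      rw [intervalIntegral.integral_const_mul, hD]
    have hVr : Continuous fun τ => 2 * (V τ).re - 1 :=
      (continuous_const.mul (Complex.continuous_re.comp hVcont)).sub continuous_const
    have hUr : Continuous fun τ => (e * U τ).re * (2 * (V τ).re - 1) :=
      (Complex.continuous_re.comp (continuous_const.mul hUc)).mul hVr
    have hVδ : Continuous fun τ => δ * (2 * (V τ).re - 1) := continuous_const.mul hVr
    rw [hδi]
    refine intervalIntegral.integral_mono_on hπ.le (hVδ.intervalIntegrable _ _)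
      (hUr.intervalIntegrable _ _) fun τ hτ => ?_
    refine mul_le_mul_of_nonneg_right (hmin hτ) ?_
    have : 1 / 2 ≤ (V τ).re := hK _ (hrot ζ hζ1 (-1) τ)
    linarith
  rw [← hE] at hF
  have : 0 < 2 * Real.pi * (e * ∑' n, p n * k n * z ^ n).re := (by positivity : 0 < δ * (2 * Real.pi)).trans_le hF
  exact (mul_pos_iff_of_pos_left hπ).1 this

end Convolution

/-! ### Series of the transform and of the W-expression; the duality test. -/

/-- The power series of the integral transform. -/
lemma hasDiscSeries_transform {lam : ℝ → ℝ} (hint : IntervalIntegrable lam volume 0 1)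
    {a : ℕ → ℂ} {f : ℂ → ℂ} (ha : HasDiscSeries a f) (h0 : a 0 = 0) :
    HasDiscSeries (fun n => a n * moment lam (n - 1)) (transform lam f) := by
  intro z hz
  -- The shift drops the index 0, where the truncated n - 1 would be meaningless but a 0 = 0.
  rw [← hasSum_nat_add_iff' 1]
  simp only [Finset.range_one, Finset.sum_singleton, h0, zero_mul, sub_zero,
    Nat.add_sub_cancel]
  have hd : Summable fun n => ‖a (n + 1) * z ^ (n + 1)‖ :=
    (summable_nat_add_iff 1).2 (ha z hz).summable.norm
  have h := hasSum_integral_mul_pow hd hint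
  have e1 : (fun n => a (n + 1) * (moment lam n : ℂ) * z ^ (n + 1))
      = fun n => a (n + 1) * z ^ (n + 1) * ((∫ t in (0 : ℝ)..1, lam t * t ^ n : ℝ) : ℂ) := by
    funext n; rw [moment]; ring
  have e2 : transform lam f z = ∫ t in (0 : ℝ)..1, (lam t : ℂ) *
      ∑' n, a (n + 1) * z ^ (n + 1) * (t : ℂ) ^ n := by
    rw [transform, intervalIntegral.integral_of_le zero_le_one,
      intervalIntegral.integral_of_le zero_le_one]
    refine setIntegral_congr_fun measurableSet_Ioc fun t ht => ?_
    have htz : (t : ℂ) * z ∈ Metric.ball (0 : ℂ) 1 := by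
      rw [mem_ball_zero_iff] at hz ⊢
      rw [norm_mul, Complex.norm_real, Real.norm_of_nonneg ht.1.le]
      exact (mul_le_of_le_one_left (norm_nonneg _) ht.2).trans_lt hz
    have ht0 : (t : ℂ) ≠ 0 := by exact_mod_cast ht.1.ne'
    have h1 := ((hasSum_nat_add_iff' 1).2 (ha _ htz)).div_const (t : ℂ)
    simp only [Finset.range_one, Finset.sum_singleton, h0, zero_mul, sub_zero] at h1
    have h2 : f (t * z) / t = ∑' n, a (n + 1) * z ^ (n + 1) * (t : ℂ) ^ n := by
      rw [← h1.tsum_eq]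
      refine tsum_congr fun n => ?_
      rw [mul_pow, div_eq_iff ht0]
      ring
    rw [h2]
  rw [e1, e2]
  exact h

/-- The power series of the differential expression defining `W_β(α, γ)`. -/
lemma hasDiscSeries_classW {α γ μ ν : ℝ} (hsum : μ + ν = α - γ) (hprod : μ * ν = γ)
    {a : ℕ → ℂ} {f : ℂ → ℂ} (ha : HasDiscSeries a f) (h0 : a 0 = 0) :
    HasDiscSeries (fun n => (1 + μ * n) * (1 + ν * n) * a (n + 1))
      (fun z => (1 - α + 2 * γ) * dslope f 0 z + (α - 2 * γ) * deriv f z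
        + γ * z * deriv (deriv f) z) := by
  have h1 := (((ha.dslope h0).const_mul (1 - α + 2 * γ)).add
    (ha.deriv.const_mul (α - 2 * γ))).add (ha.deriv.id_mul_deriv.const_mul γ)
  refine h1.congr (fun n => ?_) fun z _ => by ring
  -- The coefficient 1 + (α-γ)n + γn² factors as (1+μn)(1+νn).
  have hα : (α : ℂ) = μ + ν + μ * ν := by
    have : α = μ + ν + μ * ν := by linarith
    rw [this]; push_cast; ring
  have hγ : (γ : ℂ) = μ * ν := by rw [← hprod]; push_cast; ring
  rw [hα, hγ]
  ring

/-- A quotient has positive real part if no admissible convex combination of the numerator and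
the denominator vanishes. -/
lemma re_div_pos_of_forall {X Y e : ℂ}
    (h : ∀ w : ℂ, w.re ^ 2 + w.im ^ 2 ≤ w.re → 0 < (e * ((1 - w) * Y + w * X)).re) :
    0 < (X / Y).re := by
  have hY : Y ≠ 0 := by
    rintro rfl
    have := h 0 (by simp)
    simp at this
  by_contra! hneg
  -- If Re(X/Y) ≤ 0 then Re v ≥ 1, and inversion sends this half-plane into |w - 1/2| ≤ 1/2. The
  -- choice w = 1/v annihilates (1-w)Y + wX.
  set v : ℂ := 1 - X / Y with hv
  have hvre : 1 ≤ v.re := by rw [hv, Complex.sub_re, Complex.one_re]; linarith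
  have hv0 : v ≠ 0 := fun h0 => by rw [h0, Complex.zero_re] at hvre; linarith
  have hns : 0 < Complex.normSq v := Complex.normSq_pos.2 hv0
  have hw : (v⁻¹).re ^ 2 + (v⁻¹).im ^ 2 ≤ (v⁻¹).re := by
    have h1 : (v⁻¹).re ^ 2 + (v⁻¹).im ^ 2 = (Complex.normSq v)⁻¹ := by
      rw [← Complex.normSq_inv, Complex.normSq_apply]; ring
    rw [h1, Complex.inv_re, inv_eq_one_div]
    gcongr
  have h1 := h v⁻¹ hw
  have h2 : (1 - v⁻¹) * Y + v⁻¹ * X = 0 := by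
    have h3 : X = (1 - v) * Y := by rw [hv]; field_simp; ring
    rw [h3]
    field_simp
    ring
  rw [h2] at h1
  simp at h1

/-! ### Membership in the Pascu class. -/

section Membership

variable {ξ μ ν β : ℝ} {lam q : ℝ → ℝ}

/-- The real part of the dual kernel is at least `1/2`. -/
lemma half_le_re_dualKernel (hξ0 : 0 ≤ ξ) (hξ1 : ξ ≤ 1) (hμ : 1 ≤ μ) (hν : 0 < ν)
    {lam' lam'' : ℝ → ℝ} (hf : IsDecConvex lam lam' lam'')
    (hint : IntervalIntegrable lam volume 0 1) (hlim : Tendsto lam (𝓝[<] 1) (𝓝 0))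
    (hq : IsConvexKernel μ ν q) (hβ : β < 1)
    (hβq : (β - 1 / 2) / (1 - β) = -∫ t in (0 : ℝ)..1, lam t * q t)
    {w : ℂ} (hw : w.re ^ 2 + w.im ^ 2 ≤ w.re) :
    ∃ K, HasDiscSeries (fun n => (if n = 0 then (β : ℂ) else 0) + (1 - β) * ((1 + n * w) *
      (((moment lam n * ((1 + ξ * n) / ((1 + μ * n) * (1 + ν * n))) : ℝ)) : ℂ))) K ∧
      ∀ z ∈ Metric.ball (0 : ℂ) 1, 1 / 2 ≤ (K z).re := by
  set m : ℕ → ℝ := fun n => moment lam n * ((1 + ξ * n) / ((1 + μ * n) * (1 + ν * n))) with hm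
  set S : ℂ → ℂ := fun z => ∑' n : ℕ, (1 + n * w) * (m n : ℂ) * z ^ n with hS
  obtain ⟨M, hM⟩ : ∃ M, ∀ n, |moment lam n| ≤ M := ⟨_, abs_moment_le hint⟩
  have hmb : ∀ n, |m n| ≤ M := by
    intro n
    have hn : (0 : ℝ) ≤ n := n.cast_nonneg
    have hM0 := (abs_nonneg _).trans (hM n)
    rw [hm, abs_mul]
    refine (mul_le_of_le_one_right (abs_nonneg _) ?_).trans (hM n)
    rw [abs_of_nonneg (by positivity), div_le_one (by positivity)]
    have h1 := mul_le_mul_of_nonneg_right (hξ1.trans hμ) hn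
    have h2 : 0 ≤ (1 + μ * n) * (ν * n) := by positivity
    nlinarith
  have hSs : HasDiscSeries (fun n => (1 + n * w) * (m n : ℂ)) S := by
    intro z hz
    rw [mem_ball_zero_iff] at hz
    refine Summable.hasSum (Summable.of_norm_bounded
      ((summable_norm_star_coeff (w := w) hz).mul_right M) fun n => ?_)
    have e : (1 + (n : ℂ) * w) * (m n : ℂ) * z ^ n = (1 + n * w) * z ^ n * (m n : ℂ) := by ring
    rw [e, norm_mul, Complex.norm_real]
    exact mul_le_mul_of_nonneg_left (hmb n) (norm_nonneg _)
  refine ⟨_, (hasDiscSeries_const (β : ℂ)).add (hSs.const_mul (1 - β)), fun z hz => ?_⟩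
  have hz1 := mem_ball_zero_iff.1 hz
  have hd : Summable fun n : ℕ => ‖((1 + n * w) * z ^ n).re * moment lam n‖ := by
    refine ((summable_norm_star_coeff (w := w) hz1).mul_right M).of_nonneg_of_le
      (fun _ => norm_nonneg _) fun n => ?_
    rw [norm_mul]
    exact mul_le_mul (Complex.abs_re_le_norm _) (hM n) (norm_nonneg _) (norm_nonneg _)
  have hmain := integral_mul_convexKernel_le hμ hν hξ0 hξ1 hq hf.nonneg hint hd
    fun r hr => scaleAvg_koebeKernel_le_tsum hf hint hlim hz1 hw hr
  have hre : (S z).re = ∑' n : ℕ, ((1 + n * w) * z ^ n).re * moment lam n *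
      ((1 + ξ * n) / ((1 + μ * n) * (1 + ν * n))) := by
    rw [← (Complex.hasSum_re (hSs z hz)).tsum_eq]
    refine tsum_congr fun n => ?_
    have e : (1 + (n : ℂ) * w) * (m n : ℂ) * z ^ n = (1 + n * w) * z ^ n * (m n : ℂ) := by ring
    rw [e, Complex.re_mul_ofReal, hm, mul_assoc]
  rw [← hre] at hmain
  have hβ1 : 0 < 1 - β := by linarith
  -- The condition on β says exactly that a lower bound ∫λq for Re S gives β + (1-β) Re S ≥ 1/2.
  have h1 : (1 - β) * ∫ t in (0 : ℝ)..1, lam t * q t = 1 / 2 - β := by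
    rw [div_eq_iff hβ1.ne'] at hβq
    linarith
  have h2 := mul_le_mul_of_nonneg_left hmain hβ1.le
  have h3 : ((β : ℂ) + (1 - β) * S z).re = β + (1 - β) * (S z).re := by
    have : (1 - (β : ℂ)) = ((1 - β : ℝ) : ℂ) := by push_cast; ring
    rw [this, Complex.add_re, Complex.ofReal_re, Complex.re_ofReal_mul]
  rw [h3]
  linarith

/-- Membership in the Pascu class for the transform with a decreasing convex weight. -/
theorem classM_transform {α γ : ℝ} {f : ℂ → ℂ} (hξ0 : 0 ≤ ξ) (hξ1 : ξ ≤ 1) (hμ : 1 ≤ μ)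
    (hν : 0 < ν) (hsum : μ + ν = α - γ) (hprod : μ * ν = γ)
    {lam' lam'' : ℝ → ℝ} (hdc : IsDecConvex lam lam' lam'')
    (hint : IntervalIntegrable lam volume 0 1) (hlim : Tendsto lam (𝓝[<] 1) (𝓝 0))
    (hnorm : ∫ t in (0 : ℝ)..1, lam t = 1)
    (hq : IsConvexKernel μ ν q) (hβ : β < 1)
    (hβq : (β - 1 / 2) / (1 - β) = -∫ t in (0 : ℝ)..1, lam t * q t)
    (hf : ClassW β α γ f) : ClassM ξ (transform lam f) := by
  obtain ⟨⟨hfd, hf0, hf1⟩, θ, hθ⟩ := hf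
  set a : ℕ → ℂ := fun n => iteratedDeriv n f 0 / n.factorial with ha_def
  have ha : HasDiscSeries a f := hasDiscSeries_taylor hfd
  have ha0 : a 0 = 0 := by rw [← ha.apply_zero, hf0]
  have ha1 : a 1 = 1 := by
    have := ha.deriv.apply_zero
    rw [hf1] at this
    simpa using this.symm
  have hΛ0 : moment lam 0 = 1 := by simpa [moment] using hnorm
  set F := transform lam f
  set b : ℕ → ℂ := fun n => a n * moment lam (n - 1) with hb_def
  have hb : HasDiscSeries b F := hasDiscSeries_transform hint ha ha0
  have hb0 : b 0 = 0 := by simp [hb_def, ha0]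
  refine ⟨⟨hb.differentiableOn, by rw [hb.apply_zero, hb0], ?_⟩, fun z hz hz0 => ?_⟩
  · rw [hb.deriv.apply_zero]
    simp [hb_def, ha1, hΛ0]
  have hβ1 : (1 - (β : ℂ)) ≠ 0 := by
    have : (1 - β) ≠ 0 := by linarith
    exact_mod_cast this
  have hH := hasDiscSeries_classW hsum hprod ha ha0
  have hP := (hH.add (hasDiscSeries_const (-(β : ℂ)))).const_mul (1 - (β : ℂ))⁻¹
  have hnum := (hb.id_mul_deriv.id_mul_deriv.const_mul ξ).add (hb.id_mul_deriv.const_mul (1 - ξ))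
  have hden := (hb.id_mul_deriv.const_mul ξ).add (hb.const_mul (1 - ξ))
  have hnum_z := hnum.hasSum_div (by simp) hz hz0
  have hden_z := hden.hasSum_div (by simp [hb0]) hz hz0
  set X := ξ * (z * deriv (fun w => w * deriv F w) z) + (1 - ξ) * (z * deriv F z) with hX
  set Y := ξ * (z * deriv F z) + (1 - ξ) * F z with hY
  have hgoal : (ξ * z * deriv (fun w => w * deriv F w) z + (1 - ξ) * (z * deriv F z)) / Y
      = X / z / (Y / z) := by
    rw [div_div_div_cancel_right₀ hz0, hX, mul_assoc]
  rw [hgoal]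
  refine re_div_pos_of_forall (e := Complex.exp (θ * Complex.I)) fun w hw => ?_
  obtain ⟨K, hK, hKre⟩ := half_le_re_dualKernel hξ0 hξ1 hμ hν hdc hint hlim hq hβ hβq hw
  have hpos := hP.convolution_re_pos hK (e := Complex.exp (θ * Complex.I)) ?_ ?_ ?_ hKre hz
  · refine hpos.trans_eq ?_
    congr 2
    have hadd := (hden_z.mul_left (1 - w)).add (hnum_z.mul_left w)
    rw [← hadd.tsum_eq]
    refine tsum_congr fun n => ?_
    -- The index 0 is separate because β is subtracted from the constant term of P and added to that
    -- of K, which makes both equal to 1. For n ≥ 1 the factors 1-β and (1+μn)(1+νn) cancel.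
    rcases eq_or_ne n 0 with rfl | hn
    · simp [hb_def, ha1, hΛ0]
      field_simp
      ring
    · have hn0 : (0 : ℝ) ≤ n := n.cast_nonneg
      have hμn : (1 + (μ : ℂ) * n) ≠ 0 := by
        have : 1 + μ * n ≠ 0 := by positivity
        exact_mod_cast this
      have hνn : (1 + (ν : ℂ) * n) ≠ 0 := by
        have : 1 + ν * n ≠ 0 := by positivity
        exact_mod_cast this
      simp only [if_neg hn, hb_def, Nat.add_sub_cancel]
      push_cast
      generalize 1 + (μ : ℂ) * n = x at hμn ⊢
      generalize 1 + (ν : ℂ) * n = y at hνn ⊢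
      field_simp
      ring
  · simp [ha1]
    field_simp
    ring
  · simp [hΛ0]
  · intro u hu
    have h1 := hθ u hu
    have hβr : 0 < (1 - β)⁻¹ := by
      have : 0 < 1 - β := by linarith
      positivity
    have e1 : (1 - (β : ℂ))⁻¹ = (((1 - β)⁻¹ : ℝ) : ℂ) := by push_cast; ring
    rw [mul_left_comm, e1, Complex.re_ofReal_mul]
    refine mul_pos hβr ?_
    rw [← sub_eq_add_neg]
    exact h1

end Membership

end PascuTransform

theorem mainTheorem6
    (ξ μ ν α γ β k A B C : ℝ) (φ q : ℝ → ℝ) (f : ℂ → ℂ)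
    (hξ0 : 0 ≤ ξ) (hξ1 : ξ ≤ 1)
    (hγ : 0 < γ) (hμ : 1 ≤ μ) (hν : 0 ≤ ν)
    (hsum : μ + ν = α - γ) (hprod : μ * ν = γ)
    (hB1 : B < 1) (hB : B < min (2 + 1 / μ) (C - A - 1))
    (hφ : PascuTransform.IsHypergeometricFactor φ)
    (hint : IntervalIntegrable (PascuTransform.weight k A B C φ) MeasureTheory.volume 0 1)
    (hnorm : ∫ t in (0 : ℝ)..1, PascuTransform.weight k A B C φ t = 1)
    (hq : PascuTransform.IsConvexKernel μ ν q)
    (hβ : β < 1)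
    (hβq : (β - 1 / 2) / (1 - β) = -∫ t in (0 : ℝ)..1, PascuTransform.weight k A B C φ t * q t)
    (hf : PascuTransform.ClassW β α γ f) :
    PascuTransform.ClassM ξ
      (PascuTransform.transform (PascuTransform.weight k A B C φ) f) := by
  -- With ν = 0 the product μν = γ would vanish, against γ > 0.
  have hν0 : 0 < ν := hν.lt_of_ne (by rintro rfl; simp at hprod; linarith)
  have hk := (PascuTransform.weight_const_pos hφ hnorm).le
  have hB2 : B ≤ C - A - 1 := (hB.trans_le (min_le_right _ _)).le
  obtain ⟨lam', lam'', hdc⟩ := PascuTransform.isDecConvex_weight hk hB1.le hB2 hφ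
  exact PascuTransform.classM_transform hξ0 hξ1 hμ hν0 hsum hprod hdc hint
    (PascuTransform.tendsto_weight_one hk hB1.le hB2 hφ) hnorm hq hβ hβq hf
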